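/- Let $V$ be a finite set. A weighted graph on $V$ is a function $w\colon V\times V\to\mathbb R_{\ge 0}$ (not assumed symmetric). For a word $x=x_1\cdots x_n\in V^n$ and a permutation $\sigma\in S_n$ (the symbol $x_{\sigma(t)}$ arrives at time $t$), let $L_t$ (resp. $R_t$) be the set of indices $\sigma(s)$ with $s<t$ and $\sigma(s)<\sigma(t)$ (resp. $\sigma(s)>\sigma(t)$), and set \[ w(x;\sigma)=\prod_{t\colon L_t\neq\emptyset} w\bigl(x_{\max L_t},x_{\sigma(t)}\bigr)\prod_{t\colon R_t\neq\emptyset} w\bigl(x_{\sigma(t)},x_{\min R_t}\bigr),\qquad B(x)=\sum_{\sigma\in S_n}w(x;\sigma),\qquad \mathbb P_n(x)=\frac{B(x)}{\sum_{y\in V^n}B(y)} . \] The insertion algorithm on the weighted graph is consistent if every $\mathbb P_n$ is well defined, i.e. $\sum_{y\in V^n}B(y)>0$ for all $n$, and $\mathbb P_n(x)=\sum_{v\in V}\mathbb P_{n+1}(xv)=\sum_{v\in V}\mathbb P_{n+1}(vx)$ for all $n$ and all $x\in V^n$. In that case there is a process $(X_i)_{i\in\mathbb Z}$, unique in law and stationary,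 in which every block of $n$ consecutive coordinates has law $\mathbb P_n$: the insertion process. A stationary process is $k$-dependent if $(X_i)_{i<0}$ and $(X_i)_{i\ge k}$ are independent. Theorem 3. Let $w$ be a weighted graph on a finite set $V$ such that $w(i,i)=0$ for all $i\in V$ and $w(i,j)>0$ for all distinct $i,j\in V$, and let $k\ge 0$ be an integer. Then the insertion algorithm on $w$ is consistent and its insertion process is $k$-dependent if and only if either $w$ is the unweighted complete graph $K_3$ and $k\ge 2$, or $w$ is the unweighted complete graph $K_4$ and $k\ge 1$. Here $w$ is the unweighted complete graph $K_q$ if $|V|=q$ and $w(i,j)=1$ for all $i\neq j$, $w(i,i)=0$. -/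

import Mathlib

open scoped NNReal ENNReal

noncomputable section

namespace InsertionProcess

variable {V : Type*}

/-- The indices to the left of `σ t` whose symbols have arrived before time `t`
(the symbol with index `σ s` arrives at time `s`). -/
def leftIndices {n : ℕ} (σ : Equiv.Perm (Fin n)) (t : Fin n) : Finset (Fin n) :=
  (Finset.univ.filter fun s : Fin n => s < t ∧ σ s < σ t).image σ

/-- The indices to the right of `σ t` whose symbols have arrived before time `t`. -/
def rightIndices {n : ℕ} (σ : Equiv.Perm (Fin n)) (t : Fin n) : Finset (Fin n) :=
  (Finset.univ.filter fun s : Fin n => s < t ∧ σ t < σ s).image σ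

open Classical in
/-- The weight of the edge joining the symbol that arrives at time `t` to the nearest symbol
present on its left (`1` if there is none). -/
def leftFactor (w : V → V → ℝ≥0) {n : ℕ} (x : Fin n → V) (σ : Equiv.Perm (Fin n))
    (t : Fin n) : ℝ≥0 :=
  if h : (leftIndices σ t).Nonempty then w (x ((leftIndices σ t).max' h)) (x (σ t)) else 1

open Classical in
/-- The weight of the edge joining the symbol that arrives at time `t` to the nearest symbol
present on its right (`1` if there is none). -/
def rightFactor (w : V → V → ℝ≥0) {n : ℕ} (x : Fin n → V) (σ : Equiv.Perm (Fin n))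
    (t : Fin n) : ℝ≥0 :=
  if h : (rightIndices σ t).Nonempty then w (x (σ t)) (x ((rightIndices σ t).min' h)) else 1

/-- The building weight `w(x; σ)`: the product of all edge weights of the constraint graph. -/
def buildingWeight (w : V → V → ℝ≥0) {n : ℕ} (x : Fin n → V) (σ : Equiv.Perm (Fin n)) : ℝ≥0 :=
  (∏ t : Fin n, leftFactor w x σ t) * ∏ t : Fin n, rightFactor w x σ t

/-- The weighted building count `B(x)` of a word `x` of length `n`. -/
def buildingCount (w : V → V → ℝ≥0) {n : ℕ} (x : Fin n → V) : ℝ≥0 :=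
  ∑ σ : Equiv.Perm (Fin n), buildingWeight w x σ

/-- The normalizing constant: the total building count of all words of length `n`. -/
def totalCount [Fintype V] (w : V → V → ℝ≥0) (n : ℕ) : ℝ≥0 :=
  ∑ x : Fin n → V, buildingCount w x

/-- The probability `ℙₙ(x)` that the insertion algorithm outputs the word `x`
(meaningful when `totalCount w n ≠ 0`). -/
def insertionProb [Fintype V] (w : V → V → ℝ≥0) {n : ℕ} (x : Fin n → V) : ℝ≥0 :=
  buildingCount w x / totalCount w n

/-- The insertion algorithm is consistent: every `ℙₙ` is well defined as a probability
distribution, and removing the last or the first symbol of a word with law `ℙₙ₊₁` gives a word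
with law `ℙₙ`. -/
def Consistent [Fintype V] (w : V → V → ℝ≥0) : Prop :=
  (∀ n : ℕ, 0 < totalCount w n) ∧
  ∀ (n : ℕ) (x : Fin n → V),
    insertionProb w x = ∑ v : V, insertionProb w (Fin.snoc x v : Fin (n + 1) → V) ∧
    insertionProb w x = ∑ v : V, insertionProb w (Fin.cons v x : Fin (n + 1) → V)

/-- `μ` is the law of the insertion process: a probability measure on `V^ℤ` under which every
block of `n` consecutive coordinates has distribution `ℙₙ`. -/
def IsInsertionProcess [Fintype V] [MeasurableSpace V] (w : V → V → ℝ≥0)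
    (μ : MeasureTheory.Measure (ℤ → V)) : Prop :=
  MeasureTheory.IsProbabilityMeasure μ ∧
  ∀ (i : ℤ) (n : ℕ) (x : Fin n → V),
    μ {y : ℤ → V | ∀ j : Fin n, y (i + ((j : ℕ) : ℤ)) = x j} = (insertionProb w x : ℝ≥0∞)

/-- The (stationary) process with law `μ` is `k`-dependent: `(X i)_{i < 0}` and `(X i)_{i ≥ k}`
are independent. -/
def IsKDependent [MeasurableSpace V] (k : ℕ) (μ : MeasureTheory.Measure (ℤ → V)) : Prop :=
  ProbabilityTheory.IndepFun
    (fun (y : ℤ → V) (i : {i : ℤ // i < 0}) => y i)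
    (fun (y : ℤ → V) (i : {i : ℤ // (k : ℤ) ≤ i}) => y i) μ

/-- The weighted graph `w` is, up to relabelling its vertices, the unweighted complete graph
`K_q`. -/
def IsUnweightedComplete (q : ℕ) (w : V → V → ℝ≥0) : Prop :=
  ∃ e : V ≃ Fin q, ∀ i j : V, w i j = if e i = e j then 0 else 1

end InsertionProcess

end

open MeasureTheory ProbabilityTheory Filter

namespace InsertionProcess

/-! ### Building counts by recursion on the last arrival -/

section

variable {V : Type*}

/-! Write B for the building count and q for the number of vertices. Everything rests on
conditioning on the last arrival (`buildingCount_succ`): the last symbol sees both of its immediate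
neighbours, and deleting it leaves an arbitrary building of the shortened word. On an unweighted
complete graph, B of a word with distinct consecutive symbols is thus the sum of B over its
one-symbol deletions, and B vanishes on all other words.

Sufficiency. Summing this recursion over an extra end symbol gives `sum_properCount_cons`: such a
sum is (q + n(q - 2))B, a constant times B, which is consistency. Summing over one symbol a between
x and y gives a Leibniz rule in x and y with error (q - 4)B(xy) (`gapCount_recursion`); over two
symbols the error is 2q - 6 times the one-symbol sum (`doubleGapCount_recursion`). At q = 4,
respectively q = 3, the error disappears, and the pure Leibniz rule makes the sum proportional to
B(x)B(y) (`exists_factorization`). Normalization turns proportionality into independence across a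
gap of length 1, respectively 2, and larger gaps follow. The process itself is a limit of finite
windows, by compactness.

Necessity. Consistency for short words constrains sums of products of rows of w. The triple sums are
symmetric in three rows but are affine in a single entry of w, with nonzero slope
(`EdgeRelations.beta_ne_zero`); for q ≥ 3 this forces all off-diagonal weights to equal one constant
c, and a last relation gives c = 1. Now take f on V with sum zero and correlate f at both ends of a
word. Adding a symbol multiplies this correlation by -2c + nc²(q - 2) (`endSum_succ`). Under
k-dependence the correlation across a gap of length k is zero, so nc(q - 2) = 2 for some n ≤ k. This
excludes q = 2, and with c = 1 it leaves only q = 3, n = 2 and q = 4, n = 1. -/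

/-- The permutation of `Fin (n + 1)` sending the last time to `i` and ordering the other indices
according to `τ`. -/
def insertLast {n : ℕ} (i : Fin (n + 1)) (τ : Equiv.Perm (Fin n)) : Equiv.Perm (Fin (n + 1)) :=
  (finSuccEquiv' (Fin.last n)).trans (τ.optionCongr.trans (finSuccEquiv' i).symm)

@[simp] lemma insertLast_last {n : ℕ} (i : Fin (n + 1)) (τ : Equiv.Perm (Fin n)) :
    insertLast i τ (Fin.last n) = i := by
  simp [insertLast]

@[simp] lemma insertLast_castSucc {n : ℕ} (i : Fin (n + 1)) (τ : Equiv.Perm (Fin n)) (t : Fin n) :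
    insertLast i τ t.castSucc = i.succAbove (τ t) := by
  have h : finSuccEquiv' (Fin.last n) t.castSucc = some t := by
    rw [← Fin.succAbove_last_apply, finSuccEquiv'_succAbove]
  simp [insertLast, h]

lemma insertLast_bijective (n : ℕ) :
    Function.Bijective (fun p : Fin (n + 1) × Equiv.Perm (Fin n) => insertLast p.1 p.2) := by
  rw [Fintype.bijective_iff_injective_and_card]
  constructor
  · rintro ⟨i, τ⟩ ⟨j, ρ⟩ h
    have hi : i = j := by
      simpa using congrArg (fun σ : Equiv.Perm (Fin (n + 1)) => σ (Fin.last n)) h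
    subst hi
    refine Prod.ext rfl (Equiv.ext fun t => ?_)
    have := congrArg (fun σ : Equiv.Perm (Fin (n + 1)) => σ t.castSucc) h
    simpa using this
  · simp [Fintype.card_perm, Nat.factorial_succ]

lemma mem_leftIndices {n : ℕ} {σ : Equiv.Perm (Fin n)} {t j : Fin n} :
    j ∈ leftIndices σ t ↔ ∃ s, (s < t ∧ σ s < σ t) ∧ σ s = j := by
  simp [leftIndices]

lemma mem_rightIndices {n : ℕ} {σ : Equiv.Perm (Fin n)} {t j : Fin n} :
    j ∈ rightIndices σ t ↔ ∃ s, (s < t ∧ σ t < σ s) ∧ σ s = j := by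
  simp [rightIndices]

lemma leftFactor_eq_of_isGreatest (w : V → V → ℝ≥0) {n : ℕ} (x : Fin n → V)
    {σ : Equiv.Perm (Fin n)} {t j : Fin n} (hj : IsGreatest (leftIndices σ t : Set (Fin n)) j) :
    leftFactor w x σ t = w (x j) (x (σ t)) := by
  have hne : (leftIndices σ t).Nonempty := ⟨j, hj.1⟩
  rw [leftFactor, dif_pos hne, (Finset.isGreatest_max' _ hne).unique hj]

lemma rightFactor_eq_of_isLeast (w : V → V → ℝ≥0) {n : ℕ} (x : Fin n → V)
    {σ : Equiv.Perm (Fin n)} {t j : Fin n} (hj : IsLeast (rightIndices σ t : Set (Fin n)) j) :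
    rightFactor w x σ t = w (x (σ t)) (x j) := by
  have hne : (rightIndices σ t).Nonempty := ⟨j, hj.1⟩
  rw [rightFactor, dif_pos hne, (Finset.isLeast_min' _ hne).unique hj]

lemma mem_leftIndices_insertLast {n : ℕ} {i : Fin (n + 1)} {τ : Equiv.Perm (Fin n)} {t : Fin n}
    {j : Fin (n + 1)} :
    j ∈ leftIndices (insertLast i τ) t.castSucc ↔ ∃ k ∈ leftIndices τ t, i.succAbove k = j := by
  simp only [mem_leftIndices]
  constructor
  · rintro ⟨s, ⟨hs, hσ⟩, rfl⟩
    induction s using Fin.lastCases with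
    | last => exact absurd hs (by simp [Fin.le_last])
    | cast s => exact ⟨τ s, ⟨s, ⟨by simpa using hs, by simpa using hσ⟩, rfl⟩, by simp⟩
  · rintro ⟨k, ⟨s, ⟨hs, hσ⟩, rfl⟩, rfl⟩
    exact ⟨s.castSucc, ⟨by simpa using hs, by simpa using hσ⟩, by simp⟩

lemma mem_rightIndices_insertLast {n : ℕ} {i : Fin (n + 1)} {τ : Equiv.Perm (Fin n)} {t : Fin n}
    {j : Fin (n + 1)} :
    j ∈ rightIndices (insertLast i τ) t.castSucc ↔ ∃ k ∈ rightIndices τ t, i.succAbove k = j := by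
  simp only [mem_rightIndices]
  constructor
  · rintro ⟨s, ⟨hs, hσ⟩, rfl⟩
    induction s using Fin.lastCases with
    | last => exact absurd hs (by simp [Fin.le_last])
    | cast s => exact ⟨τ s, ⟨s, ⟨by simpa using hs, by simpa using hσ⟩, rfl⟩, by simp⟩
  · rintro ⟨k, ⟨s, ⟨hs, hσ⟩, rfl⟩, rfl⟩
    exact ⟨s.castSucc, ⟨by simpa using hs, by simpa using hσ⟩, by simp⟩

/-- An earlier arrival does not see index `i`, and `i.succAbove` is increasing, so it carries
nearest present neighbours to nearest present neighbours. -/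
lemma leftFactor_insertLast_castSucc (w : V → V → ℝ≥0) {n : ℕ} (x : Fin (n + 1) → V)
    (i : Fin (n + 1)) (τ : Equiv.Perm (Fin n)) (t : Fin n) :
    leftFactor w x (insertLast i τ) t.castSucc = leftFactor w (i.removeNth x) τ t := by
  by_cases h : (leftIndices τ t).Nonempty
  · have hm := Finset.isGreatest_max' _ h
    rw [leftFactor_eq_of_isGreatest w _ hm, leftFactor_eq_of_isGreatest w x
      (j := i.succAbove ((leftIndices τ t).max' h)), insertLast_castSucc]
    · rfl
    · refine ⟨mem_leftIndices_insertLast.2 ⟨_, hm.1, rfl⟩, fun j hj => ?_⟩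
      obtain ⟨k, hk, rfl⟩ := mem_leftIndices_insertLast.1 hj
      exact Fin.succAbove_le_succAbove_iff.2 (hm.2 hk)
  · rw [leftFactor, leftFactor, dif_neg h, dif_neg]
    rintro ⟨j, hj⟩
    obtain ⟨k, hk, rfl⟩ := mem_leftIndices_insertLast.1 hj
    exact h ⟨k, hk⟩

lemma rightFactor_insertLast_castSucc (w : V → V → ℝ≥0) {n : ℕ} (x : Fin (n + 1) → V)
    (i : Fin (n + 1)) (τ : Equiv.Perm (Fin n)) (t : Fin n) :
    rightFactor w x (insertLast i τ) t.castSucc = rightFactor w (i.removeNth x) τ t := by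
  by_cases h : (rightIndices τ t).Nonempty
  · have hm := Finset.isLeast_min' _ h
    rw [rightFactor_eq_of_isLeast w _ hm, rightFactor_eq_of_isLeast w x
      (j := i.succAbove ((rightIndices τ t).min' h)), insertLast_castSucc]
    · rfl
    · refine ⟨mem_rightIndices_insertLast.2 ⟨_, hm.1, rfl⟩, fun j hj => ?_⟩
      obtain ⟨k, hk, rfl⟩ := mem_rightIndices_insertLast.1 hj
      exact Fin.succAbove_le_succAbove_iff.2 (hm.2 hk)
  · rw [rightFactor, rightFactor, dif_neg h, dif_neg]
    rintro ⟨j, hj⟩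
    obtain ⟨k, hk, rfl⟩ := mem_rightIndices_insertLast.1 hj
    exact h ⟨k, hk⟩

/-- The weight of the edge between the symbol at `i` and its left neighbour, if there is one. -/
def leftEdge (w : V → V → ℝ≥0) {n : ℕ} (x : Fin (n + 1) → V) (i : Fin (n + 1)) : ℝ≥0 :=
  Fin.cases 1 (fun j => w (x j.castSucc) (x j.succ)) i

/-- The weight of the edge between the symbol at `i` and its right neighbour, if there is one. -/
def rightEdge (w : V → V → ℝ≥0) {n : ℕ} (x : Fin (n + 1) → V) (i : Fin (n + 1)) : ℝ≥0 :=
  Fin.lastCases 1 (fun j => w (x j.castSucc) (x j.succ)) i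

@[simp] lemma leftEdge_zero (w : V → V → ℝ≥0) {n : ℕ} (x : Fin (n + 1) → V) :
    leftEdge w x 0 = 1 := rfl

@[simp] lemma leftEdge_succ (w : V → V → ℝ≥0) {n : ℕ} (x : Fin (n + 1) → V) (j : Fin n) :
    leftEdge w x j.succ = w (x j.castSucc) (x j.succ) := rfl

@[simp] lemma rightEdge_last (w : V → V → ℝ≥0) {n : ℕ} (x : Fin (n + 1) → V) :
    rightEdge w x (Fin.last n) = 1 := by simp [rightEdge]

@[simp] lemma rightEdge_castSucc (w : V → V → ℝ≥0) {n : ℕ} (x : Fin (n + 1) → V) (j : Fin n) :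
    rightEdge w x j.castSucc = w (x j.castSucc) (x j.succ) := by simp [rightEdge]

lemma exists_insertLast_apply_castSucc {n : ℕ} {i j : Fin (n + 1)} (τ : Equiv.Perm (Fin n))
    (h : j ≠ i) : ∃ s : Fin n, insertLast i τ s.castSucc = j := by
  obtain ⟨k, rfl⟩ := Fin.exists_succAbove_eq h
  exact ⟨τ.symm k, by simp⟩

/-- At the last time every other index is occupied, so the nearest symbol on the left is the
adjacent one. -/
lemma leftFactor_insertLast_last (w : V → V → ℝ≥0) {n : ℕ} (x : Fin (n + 1) → V)
    (i : Fin (n + 1)) (τ : Equiv.Perm (Fin n)) :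
    leftFactor w x (insertLast i τ) (Fin.last n) = leftEdge w x i := by
  induction i using Fin.cases with
  | zero =>
    rw [leftFactor, dif_neg, leftEdge_zero]
    rintro ⟨j, hj⟩
    obtain ⟨s, ⟨-, hs⟩, -⟩ := mem_leftIndices.1 hj
    simp at hs
  | succ i =>
    obtain ⟨s, hs⟩ := exists_insertLast_apply_castSucc (i := i.succ) (j := i.castSucc) τ
      i.castSucc_lt_succ.ne
    rw [leftFactor_eq_of_isGreatest w x (j := i.castSucc), insertLast_last, leftEdge_succ]
    refine ⟨mem_leftIndices.2 ⟨s.castSucc, ⟨s.castSucc_lt_last, ?_⟩, hs⟩, fun j hj => ?_⟩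
    · rw [hs, insertLast_last]
      exact i.castSucc_lt_succ
    · obtain ⟨r, ⟨-, hr⟩, rfl⟩ := mem_leftIndices.1 hj
      rw [insertLast_last] at hr
      exact Fin.le_castSucc_iff.2 hr

lemma rightFactor_insertLast_last (w : V → V → ℝ≥0) {n : ℕ} (x : Fin (n + 1) → V)
    (i : Fin (n + 1)) (τ : Equiv.Perm (Fin n)) :
    rightFactor w x (insertLast i τ) (Fin.last n) = rightEdge w x i := by
  induction i using Fin.lastCases with
  | last =>
    rw [rightFactor, dif_neg, rightEdge_last]
    rintro ⟨j, hj⟩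
    obtain ⟨s, ⟨-, hs⟩, -⟩ := mem_rightIndices.1 hj
    rw [insertLast_last] at hs
    exact absurd hs (Fin.le_last _).not_gt
  | cast i =>
    obtain ⟨s, hs⟩ := exists_insertLast_apply_castSucc (i := i.castSucc) (j := i.succ) τ
      i.castSucc_lt_succ.ne'
    rw [rightFactor_eq_of_isLeast w x (j := i.succ), insertLast_last, rightEdge_castSucc]
    refine ⟨mem_rightIndices.2 ⟨s.castSucc, ⟨s.castSucc_lt_last, ?_⟩, hs⟩, fun j hj => ?_⟩
    · rw [hs, insertLast_last]
      exact i.castSucc_lt_succ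
    · obtain ⟨r, ⟨-, hr⟩, rfl⟩ := mem_rightIndices.1 hj
      rw [insertLast_last] at hr
      exact Fin.castSucc_lt_iff_succ_le.1 hr

lemma buildingWeight_insertLast (w : V → V → ℝ≥0) {n : ℕ} (x : Fin (n + 1) → V)
    (i : Fin (n + 1)) (τ : Equiv.Perm (Fin n)) :
    buildingWeight w x (insertLast i τ) =
      leftEdge w x i * rightEdge w x i * buildingWeight w (i.removeNth x) τ := by
  simp only [buildingWeight, Fin.prod_univ_castSucc, leftFactor_insertLast_last,
    rightFactor_insertLast_last, leftFactor_insertLast_castSucc, rightFactor_insertLast_castSucc]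
  ring

/-- The building count satisfies a recursion over the position of the last arrival. -/
lemma buildingCount_succ (w : V → V → ℝ≥0) {n : ℕ} (x : Fin (n + 1) → V) :
    buildingCount w x =
      ∑ i, leftEdge w x i * rightEdge w x i * buildingCount w (i.removeNth x) := by
  rw [buildingCount, ← (insertLast_bijective n).sum_comp, Fintype.sum_prod_type]
  simp only [buildingWeight_insertLast, buildingCount, Finset.mul_sum]

@[simp] lemma buildingCount_zero (w : V → V → ℝ≥0) (x : Fin 0 → V) : buildingCount w x = 1 := by
  simp [buildingCount, buildingWeight]

/-- Of two adjacent indices, the one filled later finds the other as its nearest neighbour, so the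
edge between them is a factor for every arrival order. -/
lemma buildingWeight_eq_zero (w : V → V → ℝ≥0) {n : ℕ} (x : Fin (n + 1) → V) (j : Fin n)
    (h : w (x j.castSucc) (x j.succ) = 0) (σ : Equiv.Perm (Fin (n + 1))) :
    buildingWeight w x σ = 0 := by
  obtain ⟨s, hs⟩ := σ.surjective j.castSucc
  obtain ⟨t, ht⟩ := σ.surjective j.succ
  have hlt : σ s < σ t := by rw [hs, ht]; exact j.castSucc_lt_succ
  rcases lt_trichotomy s t with hst | rfl | hst
  · refine mul_eq_zero_of_left (Finset.prod_eq_zero (Finset.mem_univ t) ?_) _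
    rw [leftFactor_eq_of_isGreatest w x (j := j.castSucc), ht, h]
    refine ⟨mem_leftIndices.2 ⟨s, ⟨hst, hlt⟩, hs⟩, fun k hk => ?_⟩
    obtain ⟨r, ⟨-, hr⟩, rfl⟩ := mem_leftIndices.1 hk
    rw [ht] at hr
    exact Fin.le_castSucc_iff.2 hr
  · exact absurd hlt (lt_irrefl _)
  · refine mul_eq_zero_of_right _ (Finset.prod_eq_zero (Finset.mem_univ s) ?_)
    rw [rightFactor_eq_of_isLeast w x (j := j.succ), hs, h]
    refine ⟨mem_rightIndices.2 ⟨t, ⟨hst, hlt⟩, ht⟩, fun k hk => ?_⟩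
    obtain ⟨r, ⟨-, hr⟩, rfl⟩ := mem_rightIndices.1 hk
    rw [hs] at hr
    exact Fin.castSucc_lt_iff_succ_le.1 hr

lemma buildingCount_eq_zero (w : V → V → ℝ≥0) {n : ℕ} (x : Fin (n + 1) → V) (j : Fin n)
    (h : w (x j.castSucc) (x j.succ) = 0) : buildingCount w x = 0 :=
  Finset.sum_eq_zero fun σ _ => buildingWeight_eq_zero w x j h σ

end

/-! ### The deletion recursion on lists and end extensions -/

section

variable {V : Type*}

/-- The sum of `F` over all words obtained from a word by deleting one symbol. -/
def removals (F : List V → ℝ) : List V → ℝ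
  | [] => 0
  | a :: l => F l + removals (fun z => F (a :: z)) l

@[simp] lemma removals_nil (F : List V → ℝ) : removals F [] = 0 := rfl

@[simp] lemma removals_cons (F : List V → ℝ) (a : V) (l : List V) :
    removals F (a :: l) = F l + removals (fun z => F (a :: z)) l := rfl

lemma removals_congr {F G : List V → ℝ} {l : List V}
    (h : ∀ z : List V, z.length + 1 = l.length → F z = G z) : removals F l = removals G l := by
  induction l generalizing F G with
  | nil => rfl
  | cons a l ih =>
    rw [removals_cons, removals_cons, h l rfl, ih]
    exact fun z hz => h _ (by simp [hz])

lemma removals_zero (l : List V) : removals (fun _ => 0) l = 0 := by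
  induction l with
  | nil => rfl
  | cons a l ih => simp [ih]

lemma removals_mul (F : List V → ℝ) (c : ℝ) (l : List V) :
    removals (fun z => c * F z) l = c * removals F l := by
  induction l generalizing F with
  | nil => simp
  | cons a l ih => rw [removals_cons, removals_cons, ih (fun z => F (a :: z)), mul_add]

lemma removals_sum {ι : Type*} (s : Finset ι) (F : ι → List V → ℝ) (l : List V) :
    removals (fun z => ∑ i ∈ s, F i z) l = ∑ i ∈ s, removals (F i) l := by
  induction l generalizing F with
  | nil => simp
  | cons a l ih =>
    simp only [removals_cons, ih (fun i z => F i (a :: z)), Finset.sum_add_distrib]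

lemma removals_append (F : List V → ℝ) (x y : List V) :
    removals F (x ++ y) =
      removals (fun z => F (z ++ y)) x + removals (fun z => F (x ++ z)) y := by
  induction x generalizing F with
  | nil => simp
  | cons a x ih => simp only [List.cons_append, removals_cons, ih, add_assoc]

lemma removals_reverse (F : List V → ℝ) (l : List V) :
    removals F l.reverse = removals (fun z => F z.reverse) l := by
  induction l generalizing F with
  | nil => rfl
  | cons a l ih => simp [removals_append, ih, add_comm]

lemma removals_ofFn (F : List V → ℝ) {n : ℕ} (x : Fin (n + 1) → V) :
    removals F (List.ofFn x) = ∑ i : Fin (n + 1), F (List.ofFn (i.removeNth x : Fin n → V)) := by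
  induction n generalizing F with
  | zero => simp
  | succ n ih =>
    have h (i : Fin (n + 1)) : List.ofFn (i.succ.removeNth x : Fin (n + 1) → V) =
        x 0 :: List.ofFn (i.removeNth (fun j => x j.succ) : Fin n → V) := by
      rw [List.ofFn_succ]
      simp only [Fin.removeNth, Fin.succ_succAbove_zero, Fin.succ_succAbove_succ]
      rfl
    rw [List.ofFn_succ, removals_cons, ih]
    refine Eq.trans ?_ (Fin.sum_univ_succ _).symm
    exact congrArg₂ (· + ·) rfl (Finset.sum_congr rfl fun i _ => (congrArg F (h i)).symm)

open Classical in
/-- Auxiliary recursion for `properCount`, over the length of the word. -/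
noncomputable def properCountAux : ℕ → List V → ℝ
  | 0, _ => 1
  | n + 1, l => if l.IsChain (· ≠ ·) then removals (properCountAux n) l else 0

/-- The number of orders in which a word can be built by successive insertions through words
whose consecutive symbols are distinct. -/
noncomputable def properCount (l : List V) : ℝ := properCountAux l.length l

@[simp] lemma properCount_nil : properCount ([] : List V) = 1 := rfl

lemma properCount_eq_zero {l : List V} (h : ¬ l.IsChain (· ≠ ·)) : properCount l = 0 := by
  cases l with
  | nil => simp at h
  | cons a l => simp only [properCount, List.length_cons, properCountAux, if_neg h]

lemma properCount_eq_removals {l : List V} (h : l.IsChain (· ≠ ·)) (hl : l ≠ []) :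
    properCount l = removals properCount l := by
  cases l with
  | nil => exact absurd rfl hl
  | cons a l =>
    simp only [properCount, List.length_cons, properCountAux, if_pos h]
    exact removals_congr fun z hz => by rw [properCount, Nat.succ_injective hz]

lemma properCount_reverse (l : List V) : properCount l.reverse = properCount l := by
  induction hn : l.length generalizing l with
  | zero => rw [List.length_eq_zero_iff.1 hn, List.reverse_nil]
  | succ n ih =>
    have hl : l ≠ [] := by rintro rfl; simp at hn
    by_cases h : l.IsChain (· ≠ ·)
    · have h' : l.reverse.IsChain (· ≠ ·) := by
        rw [List.isChain_reverse]
        exact h.imp fun _ _ => Ne.symm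
      rw [properCount_eq_removals h hl, properCount_eq_removals h' (by simpa using hl),
        removals_reverse]
      exact removals_congr fun z hz => ih z (by omega)
    · have h' : ¬ l.reverse.IsChain (· ≠ ·) := by
        rw [List.isChain_reverse]
        exact fun h' => h (h'.imp fun _ _ => Ne.symm)
      rw [properCount_eq_zero h, properCount_eq_zero h']

variable [Fintype V]

/-- For a nonempty proper word y, deleting the new symbol itself contributes q - 2 copies of the
count of y, and all other deletions are handled by induction. Each symbol of y therefore adds q - 2
to the constant, which starts at q for the empty word. -/
lemma sum_properCount_cons (y : List V) :
    ∑ a : V, properCount (a :: y) =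
      (Fintype.card V + y.length * ((Fintype.card V : ℝ) - 2)) * properCount y := by
  classical
  induction hn : y.length generalizing y with
  | zero =>
    obtain rfl := List.length_eq_zero_iff.1 hn
    simp [properCount_eq_removals]
  | succ n ih =>
    obtain ⟨c, y, rfl⟩ := List.exists_cons_of_length_eq_add_one hn
    by_cases hy : (c :: y).IsChain (· ≠ ·)
    · have key (a : V) : properCount (a :: c :: y) =
          properCount (c :: y) - (if a = c then 2 * properCount (c :: y) else 0) +
            removals (fun z => properCount (a :: z)) (c :: y) := by
        split_ifs with h
        · subst h
          rw [properCount_eq_zero (by simp), removals_cons]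
          rw [removals_congr (G := fun _ => 0), removals_zero]
          · ring
          · exact fun z _ => properCount_eq_zero (by simp)
        · rw [properCount_eq_removals (by simpa [h] using hy) (by simp), removals_cons]
          ring
      rw [Finset.sum_congr rfl fun a _ => key a, Finset.sum_add_distrib, ← removals_sum,
        removals_congr (G := fun z => (Fintype.card V + n * ((Fintype.card V : ℝ) - 2)) *
          properCount z), removals_mul, ← properCount_eq_removals hy (by simp)]
      · simp
        ring
      · exact fun z hz => ih z (by omega)
    · rw [properCount_eq_zero hy, mul_zero]
      exact Finset.sum_eq_zero fun a _ => properCount_eq_zero fun h => hy h.tail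

lemma sum_properCount_snoc (x : List V) :
    ∑ a : V, properCount (x ++ [a]) =
      (Fintype.card V + x.length * ((Fintype.card V : ℝ) - 2)) * properCount x := by
  have := sum_properCount_cons x.reverse
  rw [List.length_reverse, properCount_reverse] at this
  rw [← this]
  refine Finset.sum_congr rfl fun a _ => ?_
  rw [← properCount_reverse]
  simp

end

/-! ### Sums over one or two symbols in a gap -/

section

variable {V : Type*}

lemma isChain_append_cons {x l : List V} {b : V} :
    (x ++ b :: l).IsChain (· ≠ ·) ↔ (x ++ [b]).IsChain (· ≠ ·) ∧ (b :: l).IsChain (· ≠ ·) :=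
  List.isChain_split

-- The deletion recursion for x b a c y, corrected so that it also holds when a equals b or c. The
-- word then counts 0, but deleting the equal neighbour leaves x b c y, whose count must be
-- subtracted. Stated for every a, the identity can be summed over V.
open Classical in
lemma properCount_gap (x y : List V) (a b c : V) (hx : (x ++ [b]).IsChain (· ≠ ·))
    (hy : (c :: y).IsChain (· ≠ ·)) :
    properCount (x ++ b :: a :: c :: y) =
      removals (fun z => properCount (z ++ b :: a :: c :: y)) x +
      (properCount (x ++ a :: c :: y) - if a = b then properCount (x ++ b :: c :: y) else 0) +
      (if a = b ∨ a = c then 0 else properCount (x ++ b :: c :: y)) +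
      (properCount (x ++ b :: a :: y) - if a = c then properCount (x ++ b :: c :: y) else 0) +
      removals (fun z => properCount (x ++ b :: a :: c :: z)) y := by
  by_cases h : a = b ∨ a = c
  · have hz (z t : List V) : properCount (z ++ b :: a :: c :: t) = 0 :=
      properCount_eq_zero fun hc => by
        have := (isChain_append_cons.1 hc).2
        simp only [List.isChain_cons_cons] at this
        rcases h with h | h
        · exact this.1 h.symm
        · exact this.2.1 h
    simp only [hz, removals_zero, if_pos h]
    rcases eq_or_ne a b with rfl | hab
    · rcases eq_or_ne a c with rfl | hac
      · rw [properCount_eq_zero (l := x ++ a :: a :: y)]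
        · simp
        · exact fun hc => by simpa using (isChain_append_cons.1 hc).2
      · rw [properCount_eq_zero (l := x ++ a :: a :: y)]
        · simp [hac]
        · exact fun hc => by simpa using (isChain_append_cons.1 hc).2
    · obtain rfl := h.resolve_left hab
      rw [properCount_eq_zero (l := x ++ a :: a :: y)]
      · simp [hab]
      · exact fun hc => by simpa using (isChain_append_cons.1 hc).2
  · rw [not_or] at h
    have hc : (x ++ b :: a :: c :: y).IsChain (· ≠ ·) := by
      rw [isChain_append_cons, List.isChain_cons_cons, List.isChain_cons_cons]
      exact ⟨hx, h.1 ∘ Eq.symm, h.2, hy⟩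
    rw [properCount_eq_removals hc (by simp), removals_append]
    simp only [removals_cons, h.1, h.2, if_false, or_self]
    ring

/-- A function of two words which satisfies the Leibniz-type recursion of the product of building
counts is a multiple, depending only on the lengths, of that product. -/
lemma exists_factorization (G : List V → List V → ℝ) (f g : ℕ → ℝ)
    (hleft : ∀ x y : List V, ¬ x.IsChain (· ≠ ·) → G x y = 0)
    (hright : ∀ x y : List V, ¬ y.IsChain (· ≠ ·) → G x y = 0)
    (hnil_left : ∀ y, G [] y = f y.length * properCount y)
    (hnil_right : ∀ x, G x [] = g x.length * properCount x)
    (hrec : ∀ (x y : List V) (b c : V), (x ++ [b]).IsChain (· ≠ ·) → (c :: y).IsChain (· ≠ ·) →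
      G (x ++ [b]) (c :: y) = removals (fun z => G z (c :: y)) (x ++ [b]) +
        removals (fun z => G (x ++ [b]) z) (c :: y)) (m n : ℕ) :
    ∃ K : ℝ, ∀ x y : List V, x.length = m → y.length = n →
      G x y = K * (properCount x * properCount y) := by
  induction hs : m + n generalizing m n with
  | zero =>
    refine ⟨f 0, fun x y hx hy => ?_⟩
    obtain rfl := List.length_eq_zero_iff.1 (hx.trans (by omega))
    obtain rfl := List.length_eq_zero_iff.1 (hy.trans (by omega))
    rw [hnil_left]
    simp
  | succ s ih =>
    rcases m with _ | m
    · refine ⟨f n, fun x y hx hy => ?_⟩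
      obtain rfl := List.length_eq_zero_iff.1 hx
      rw [hnil_left, hy, properCount_nil, one_mul]
    rcases n with _ | n
    · refine ⟨g (m + 1), fun x y hx hy => ?_⟩
      obtain rfl := List.length_eq_zero_iff.1 hy
      rw [hnil_right, hx, properCount_nil, mul_one]
    obtain ⟨K, hK⟩ := ih m (n + 1) (by omega)
    obtain ⟨L, hL⟩ := ih (m + 1) n (by omega)
    -- Deletions in x reduce to lengths (m, n + 1) and deletions in y to (m + 1, n). Each sum of
    -- deletions rebuilds the full product of counts, so the two constants add as in Pascal's rule.
    refine ⟨K + L, fun x y hx hy => ?_⟩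
    by_cases hcx : x.IsChain (· ≠ ·)
    swap
    · rw [hleft x y hcx, properCount_eq_zero hcx]
      ring
    by_cases hcy : y.IsChain (· ≠ ·)
    swap
    · rw [hright x y hcy, properCount_eq_zero hcy]
      ring
    have hx0 : x ≠ [] := by rintro rfl; simp at hx
    have hy0 : y ≠ [] := by rintro rfl; simp at hy
    have h1 : removals (fun z => G z y) x = K * properCount y * properCount x := by
      rw [properCount_eq_removals hcx hx0, ← removals_mul]
      refine removals_congr fun z hz => ?_
      rw [hK z y (by omega) hy]
      ring
    have h2 : removals (fun z => G x z) y = L * properCount x * properCount y := by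
      rw [properCount_eq_removals hcy hy0, ← removals_mul]
      refine removals_congr fun z hz => ?_
      rw [hL x z hx (by omega)]
      ring
    have h3 : G x y = removals (fun z => G z y) x + removals (fun z => G x z) y := by
      obtain ⟨x', b, rfl⟩ := List.eq_nil_or_concat'  x |>.resolve_left hx0
      obtain ⟨c, y', rfl⟩ := List.exists_cons_of_ne_nil hy0
      exact hrec x' y' b c hcx hcy
    rw [h3, h1, h2]
    ring

variable [Fintype V]

/-- The sum of the building counts of all words `x a y` with a single symbol `a`. -/
noncomputable def gapCount (x y : List V) : ℝ := ∑ a : V, properCount (x ++ a :: y)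

/-- The sum of the building counts of all words `x a b y` with two symbols `a` and `b`. -/
noncomputable def doubleGapCount (x y : List V) : ℝ := ∑ a : V, gapCount (x ++ [a]) y

lemma gapCount_eq_zero_left {x : List V} (hx : ¬ x.IsChain (· ≠ ·)) (y : List V) :
    gapCount x y = 0 :=
  Finset.sum_eq_zero fun _ _ => properCount_eq_zero fun h => hx h.left_of_append

lemma gapCount_eq_zero_right (x : List V) {y : List V} (hy : ¬ y.IsChain (· ≠ ·)) :
    gapCount x y = 0 :=
  Finset.sum_eq_zero fun _ _ => properCount_eq_zero fun h => hy h.right_of_append.tail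

/-- Deleting the gap symbol is possible for the q - 2 values different from b and c; the corrections
at a = b and at a = c each cost one more copy of the joined word. The error coefficient is thus q -
4. -/
lemma gapCount_recursion (x y : List V) (b c : V) (hx : (x ++ [b]).IsChain (· ≠ ·))
    (hy : (c :: y).IsChain (· ≠ ·)) :
    gapCount (x ++ [b]) (c :: y) =
      removals (fun z => gapCount z (c :: y)) (x ++ [b]) +
      removals (fun z => gapCount (x ++ [b]) z) (c :: y) +
      ((Fintype.card V : ℝ) - 4) * properCount (x ++ b :: c :: y) := by
  classical
  have hN : ∑ a : V, (if a = b ∨ a = c then 0 else properCount (x ++ b :: c :: y)) =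
      ((Fintype.card V : ℝ) - 2) * properCount (x ++ b :: c :: y) := by
    -- If `b = c` only one value of a is excluded, but then the joined word counts 0.
    rcases eq_or_ne b c with rfl | hbc
    · rw [properCount_eq_zero]
      · simp
      · exact fun hc => by simpa using (isChain_append_cons.1 hc).2
    · have key (a : V) : (if a = b ∨ a = c then 0 else properCount (x ++ b :: c :: y)) =
          properCount (x ++ b :: c :: y) - (if a = b then properCount (x ++ b :: c :: y) else 0) -
            (if a = c then properCount (x ++ b :: c :: y) else 0) := by
        rcases eq_or_ne a b with rfl | h
        · simp [hbc]
        · by_cases h' : a = c <;> simp [h, h', hbc.symm]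
      rw [Finset.sum_congr rfl fun a _ => key a]
      simp only [Finset.sum_sub_distrib, Finset.sum_ite_eq', Finset.mem_univ, if_true,
        Finset.sum_const, Finset.card_univ, nsmul_eq_mul]
      ring
  have h1 : gapCount (x ++ [b]) (c :: y) = ∑ a : V, properCount (x ++ b :: a :: c :: y) := by
    simp [gapCount]
  rw [h1, Finset.sum_congr rfl fun a _ => properCount_gap x y a b c hx hy]
  simp only [Finset.sum_add_distrib, Finset.sum_sub_distrib, hN, Finset.sum_ite_eq',
    Finset.mem_univ, if_true, ← removals_sum, removals_append, removals_cons, removals_nil]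
  simp only [gapCount, List.append_assoc, List.cons_append, List.nil_append, List.append_nil]
  ring

lemma gapCount_nil_left (y : List V) :
    gapCount [] y = (Fintype.card V + y.length * ((Fintype.card V : ℝ) - 2)) * properCount y :=
  sum_properCount_cons y

lemma gapCount_nil_right (x : List V) :
    gapCount x [] = (Fintype.card V + x.length * ((Fintype.card V : ℝ) - 2)) * properCount x :=
  sum_properCount_snoc x

/-- Apply `gapCount_recursion` with the first gap symbol a appended to the left word, then sum over
a. Deleting a gives q copies of the one-symbol sum, the correction at a = b removes two, and the
error of the one-symbol recursion adds q - 4, for a total of 2q - 6. -/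
lemma doubleGapCount_recursion (x y : List V) (b c : V) (hx : (x ++ [b]).IsChain (· ≠ ·))
    (hy : (c :: y).IsChain (· ≠ ·)) :
    doubleGapCount (x ++ [b]) (c :: y) =
      removals (fun z => doubleGapCount z (c :: y)) (x ++ [b]) +
      removals (fun z => doubleGapCount (x ++ [b]) z) (c :: y) +
      (2 * (Fintype.card V : ℝ) - 6) * gapCount (x ++ [b]) (c :: y) := by
  classical
  have key (a : V) : gapCount (x ++ b :: [a]) (c :: y) =
      removals (fun z => gapCount (z ++ b :: [a]) (c :: y)) x +
      gapCount (x ++ [a]) (c :: y) +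
      (gapCount (x ++ [b]) (c :: y) - if a = b then 2 * gapCount (x ++ [b]) (c :: y) else 0) +
      removals (fun z => gapCount (x ++ b :: [a]) z) (c :: y) +
      ((Fintype.card V : ℝ) - 4) * properCount (x ++ b :: a :: c :: y) := by
    rcases eq_or_ne a b with rfl | hab
    · have hz (z t : List V) : gapCount (z ++ a :: [a]) t = 0 :=
        gapCount_eq_zero_left (fun hc => by simpa using (isChain_append_cons.1 hc).2) _
      have hz' : properCount (x ++ a :: a :: c :: y) = 0 :=
        properCount_eq_zero fun hc => by simpa using (isChain_append_cons.1 hc).2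
      simp only [hz, hz', removals_zero, if_true]
      ring
    · have hxa : (x ++ [b] ++ [a]).IsChain (· ≠ ·) := by
        rw [List.append_assoc]
        exact isChain_append_cons.2 ⟨hx, by simpa using hab.symm⟩
      have := gapCount_recursion (x ++ [b]) y a c hxa hy
      simp only [List.append_assoc, List.cons_append, List.nil_append] at this
      rw [this, removals_append]
      simp only [removals_cons, removals_nil, if_neg hab]
      ring
  have h1 : doubleGapCount (x ++ [b]) (c :: y) = ∑ a : V, gapCount (x ++ b :: [a]) (c :: y) := by
    simp [doubleGapCount]
  have h2 : ∑ a : V, properCount (x ++ b :: a :: c :: y) = gapCount (x ++ [b]) (c :: y) := by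
    simp [gapCount]
  rw [h1, Finset.sum_congr rfl fun a _ => key a]
  simp only [Finset.sum_add_distrib, Finset.sum_sub_distrib, ← Finset.mul_sum, h2,
    Finset.sum_ite_eq', Finset.mem_univ, if_true, Finset.sum_const, Finset.card_univ,
    nsmul_eq_mul, ← removals_sum, removals_append, removals_cons, removals_nil]
  simp only [doubleGapCount, List.append_assoc, List.cons_append, List.nil_append,
    List.append_nil]
  ring

lemma doubleGapCount_nil_left (y : List V) :
    doubleGapCount [] y =
      (Fintype.card V + (y.length + 1) * ((Fintype.card V : ℝ) - 2)) *
        (Fintype.card V + y.length * ((Fintype.card V : ℝ) - 2)) * properCount y := by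
  have h1 : doubleGapCount [] y = ∑ b : V, ∑ a : V, properCount (a :: b :: y) := by
    rw [Finset.sum_comm]
    simp [doubleGapCount, gapCount]
  rw [h1]
  simp only [sum_properCount_cons, List.length_cons, ← Finset.mul_sum]
  push_cast
  ring

lemma doubleGapCount_nil_right (x : List V) :
    doubleGapCount x [] =
      (Fintype.card V + (x.length + 1) * ((Fintype.card V : ℝ) - 2)) *
        (Fintype.card V + x.length * ((Fintype.card V : ℝ) - 2)) * properCount x := by
  simp only [doubleGapCount, gapCount_nil_right, List.length_append, List.length_singleton,
    ← Finset.mul_sum, sum_properCount_snoc]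
  push_cast
  ring

lemma exists_gapCount_eq (hV : Fintype.card V = 4) (m n : ℕ) :
    ∃ K : ℝ, ∀ x y : List V, x.length = m → y.length = n →
      gapCount x y = K * (properCount x * properCount y) :=
  exists_factorization gapCount
    (fun n => Fintype.card V + n * ((Fintype.card V : ℝ) - 2))
    (fun n => Fintype.card V + n * ((Fintype.card V : ℝ) - 2))
    (fun x y hx => gapCount_eq_zero_left hx y)
    (fun x y hy => gapCount_eq_zero_right x hy) gapCount_nil_left gapCount_nil_right
    (fun x y b c hx hy => by simp [gapCount_recursion x y b c hx hy, hV]) m n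

lemma exists_doubleGapCount_eq (hV : Fintype.card V = 3) (m n : ℕ) :
    ∃ K : ℝ, ∀ x y : List V, x.length = m → y.length = n →
      doubleGapCount x y = K * (properCount x * properCount y) :=
  exists_factorization doubleGapCount
    (fun n => (Fintype.card V + (n + 1) * ((Fintype.card V : ℝ) - 2)) *
        (Fintype.card V + n * ((Fintype.card V : ℝ) - 2)))
    (fun n => (Fintype.card V + (n + 1) * ((Fintype.card V : ℝ) - 2)) *
        (Fintype.card V + n * ((Fintype.card V : ℝ) - 2)))
    (fun x y hx => Finset.sum_eq_zero fun _ _ =>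
      gapCount_eq_zero_left (fun h => hx h.left_of_append) y)
    (fun x y hy => Finset.sum_eq_zero fun _ _ => gapCount_eq_zero_right _ hy)
    doubleGapCount_nil_left doubleGapCount_nil_right
    (fun x y b c hx hy => by
      rw [doubleGapCount_recursion x y b c hx hy, hV]
      norm_num) m n

end

/-! ### Unweighted complete graphs: consistency and factorization -/

section

variable {V : Type*}

lemma ofFn_snoc {n : ℕ} (x : Fin n → V) (v : V) :
    List.ofFn (Fin.snoc x v : Fin (n + 1) → V) = List.ofFn x ++ [v] := by
  rw [List.ofFn_succ_last]
  simp

/-- For a word with distinct consecutive symbols all edge factors in `buildingCount_succ` are 1,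
leaving the plain deletion recursion; otherwise both counts are 0. -/
lemma buildingCount_eq_properCount {w : V → V → ℝ≥0} (h0 : ∀ i, w i i = 0)
    (h1 : ∀ i j, i ≠ j → w i j = 1) {n : ℕ} (x : Fin n → V) :
    (buildingCount w x : ℝ) = properCount (List.ofFn x) := by
  induction n with
  | zero => simp
  | succ n ih =>
    by_cases hx : ∀ j : Fin n, x j.castSucc ≠ x j.succ
    · have hl (i : Fin (n + 1)) : leftEdge w x i = 1 := by
        induction i using Fin.cases with
        | zero => simp
        | succ i => simp [h1 _ _ (hx i)]
      have hr (i : Fin (n + 1)) : rightEdge w x i = 1 := by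
        induction i using Fin.lastCases with
        | last => simp
        | cast i => simp [h1 _ _ (hx i)]
      rw [buildingCount_succ, properCount_eq_removals _ (by simp), removals_ofFn]
      · simp [hl, hr, ih]
      · rw [List.isChain_ofFn]
        exact fun i hi => hx ⟨i, by omega⟩
    · push Not at hx
      obtain ⟨j, hj⟩ := hx
      rw [buildingCount_eq_zero w x j (by rw [hj, h0]), properCount_eq_zero, NNReal.coe_zero]
      rw [List.isChain_ofFn]
      exact fun h => h j (by omega) hj

variable [Fintype V]

lemma sum_fin_succ_cons {M : Type*} [AddCommMonoid M] {n : ℕ} (F : (Fin (n + 1) → V) → M) :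
    ∑ z, F z = ∑ v : V, ∑ x : Fin n → V, F (Fin.cons v x) := by
  rw [← (Fin.consEquiv (fun _ : Fin (n + 1) => V)).sum_comp, Fintype.sum_prod_type]
  rfl

lemma sum_fin_succ_snoc {M : Type*} [AddCommMonoid M] {n : ℕ} (F : (Fin (n + 1) → V) → M) :
    ∑ z, F z = ∑ x : Fin n → V, ∑ v : V, F (Fin.snoc x v) := by
  rw [← (Fin.snocEquiv (fun _ : Fin (n + 1) => V)).sum_comp, Fintype.sum_prod_type,
    Finset.sum_comm]
  rfl

lemma sum_buildingCount_snoc {w : V → V → ℝ≥0} (h0 : ∀ i, w i i = 0)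
    (h1 : ∀ i j, i ≠ j → w i j = 1) {n : ℕ} (x : Fin n → V) :
    ∑ v : V, (buildingCount w (Fin.snoc x v : Fin (n + 1) → V) : ℝ) =
      (Fintype.card V + n * ((Fintype.card V : ℝ) - 2)) * buildingCount w x := by
  have := sum_properCount_snoc (List.ofFn x)
  rw [List.length_ofFn] at this
  simp only [buildingCount_eq_properCount h0 h1, ofFn_snoc, this]

lemma sum_buildingCount_cons {w : V → V → ℝ≥0} (h0 : ∀ i, w i i = 0)
    (h1 : ∀ i j, i ≠ j → w i j = 1) {n : ℕ} (x : Fin n → V) :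
    ∑ v : V, (buildingCount w (Fin.cons v x : Fin (n + 1) → V) : ℝ) =
      (Fintype.card V + n * ((Fintype.card V : ℝ) - 2)) * buildingCount w x := by
  have := sum_properCount_cons (List.ofFn x)
  rw [List.length_ofFn] at this
  simp only [buildingCount_eq_properCount h0 h1, List.ofFn_cons, this]

lemma totalCount_succ {w : V → V → ℝ≥0} (h0 : ∀ i, w i i = 0)
    (h1 : ∀ i j, i ≠ j → w i j = 1) (n : ℕ) :
    (totalCount w (n + 1) : ℝ) =
      (Fintype.card V + n * ((Fintype.card V : ℝ) - 2)) * totalCount w n := by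
  simp only [totalCount, NNReal.coe_sum, sum_fin_succ_snoc, sum_buildingCount_snoc h0 h1,
    Finset.mul_sum]

lemma totalCount_pos {w : V → V → ℝ≥0} (h0 : ∀ i, w i i = 0)
    (h1 : ∀ i j, i ≠ j → w i j = 1) (hV : 2 ≤ Fintype.card V) (n : ℕ) : 0 < totalCount w n := by
  induction n with
  | zero => simp [totalCount]
  | succ n ih =>
    have hV' : (2 : ℝ) ≤ Fintype.card V := by exact_mod_cast hV
    rw [← NNReal.coe_pos, totalCount_succ h0 h1]
    have : (0 : ℝ) ≤ n * ((Fintype.card V : ℝ) - 2) := mul_nonneg n.cast_nonneg (by linarith)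
    exact mul_pos (by linarith) (NNReal.coe_pos.2 ih)

/-- Extending at either end multiplies building counts and the normalizing constant by the same
number, which is positive when q ≥ 2. -/
lemma consistent_of_complete {w : V → V → ℝ≥0} (h0 : ∀ i, w i i = 0)
    (h1 : ∀ i j, i ≠ j → w i j = 1) (hV : 2 ≤ Fintype.card V) : Consistent w := by
  have hV' : (2 : ℝ) ≤ Fintype.card V := by exact_mod_cast hV
  have hZ := totalCount_pos h0 h1 hV
  have key (n : ℕ) (x : Fin n → V) :
      (Fintype.card V + n * ((Fintype.card V : ℝ) - 2)) * buildingCount w x /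
        totalCount w (n + 1) = buildingCount w x / totalCount w n := by
    have hC : (0 : ℝ) < Fintype.card V + n * ((Fintype.card V : ℝ) - 2) := by
      have : (0 : ℝ) ≤ n * ((Fintype.card V : ℝ) - 2) := mul_nonneg n.cast_nonneg (by linarith)
      linarith
    rw [totalCount_succ h0 h1, mul_div_mul_left _ _ hC.ne']
  refine ⟨hZ, fun n x => ⟨?_, ?_⟩⟩
  · simp only [← NNReal.coe_inj, insertionProb, NNReal.coe_sum, NNReal.coe_div,
      ← Finset.sum_div]
    rw [sum_buildingCount_snoc h0 h1, key]
  · simp only [← NNReal.coe_inj, insertionProb, NNReal.coe_sum, NNReal.coe_div,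
      ← Finset.sum_div]
    rw [sum_buildingCount_cons h0 h1, key]

/-- Blocks separated by a gap of length `k` have a joint law proportional to the product law. -/
def GapFactorizes (w : V → V → ℝ≥0) (k : ℕ) : Prop :=
  ∀ m n : ℕ, ∃ κ : ℝ, ∀ (x : Fin m → V) (y : Fin n → V),
    ∑ a : Fin k → V, (insertionProb w (Fin.append (Fin.append x a) y) : ℝ) =
      κ * (insertionProb w x * insertionProb w y)

lemma gapFactorizes_of_sum_eq {w : V → V → ℝ≥0} (hZ : ∀ n, 0 < totalCount w n) {k : ℕ}
    (h : ∀ m n : ℕ, ∃ K : ℝ, ∀ (x : Fin m → V) (y : Fin n → V),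
      ∑ a : Fin k → V, (buildingCount w (Fin.append (Fin.append x a) y) : ℝ) =
        K * (buildingCount w x * buildingCount w y)) : GapFactorizes w k := by
  intro m n
  obtain ⟨K, hK⟩ := h m n
  refine ⟨K * (totalCount w m * totalCount w n) / totalCount w (m + k + n), fun x y => ?_⟩
  have hZ' (n : ℕ) : (totalCount w n : ℝ) ≠ 0 := (NNReal.coe_pos.2 (hZ n)).ne'
  have h1 := hZ' m
  have h2 := hZ' n
  have h3 := hZ' (m + k + n)
  simp only [insertionProb, NNReal.coe_div, ← Finset.sum_div, hK]
  field_simp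

lemma gapFactorizes_one {w : V → V → ℝ≥0} (h0 : ∀ i, w i i = 0)
    (h1 : ∀ i j, i ≠ j → w i j = 1) (hV : Fintype.card V = 4) : GapFactorizes w 1 := by
  refine gapFactorizes_of_sum_eq (totalCount_pos h0 h1 (by omega)) fun m n => ?_
  obtain ⟨K, hK⟩ := exists_gapCount_eq hV m n
  refine ⟨K, fun x y => ?_⟩
  have := hK (List.ofFn x) (List.ofFn y) (by simp) (by simp)
  simp only [buildingCount_eq_properCount h0 h1, ← this, List.ofFn_fin_append, sum_fin_succ_cons,
    gapCount, List.ofFn_cons]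
  simp

lemma gapFactorizes_two {w : V → V → ℝ≥0} (h0 : ∀ i, w i i = 0)
    (h1 : ∀ i j, i ≠ j → w i j = 1) (hV : Fintype.card V = 3) : GapFactorizes w 2 := by
  refine gapFactorizes_of_sum_eq (totalCount_pos h0 h1 (by omega)) fun m n => ?_
  obtain ⟨K, hK⟩ := exists_doubleGapCount_eq hV m n
  refine ⟨K, fun x y => ?_⟩
  have := hK (List.ofFn x) (List.ofFn y) (by simp) (by simp)
  simp only [buildingCount_eq_properCount h0 h1, ← this, List.ofFn_fin_append, sum_fin_succ_cons,
    doubleGapCount, gapCount, List.ofFn_cons]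
  simp

end

/-! ### Existence of the process by compactness -/

section

variable {V : Type*}

/-- The two-sided sequence with a given word at the positions starting from `s` and a constant
symbol elsewhere. -/
def extendWord (v₀ : V) (s : ℤ) {n : ℕ} (z : Fin n → V) : ℤ → V := fun i =>
  if h : s ≤ i ∧ i < s + n then z ⟨(i - s).toNat, by omega⟩ else v₀

lemma extendWord_apply (v₀ : V) (s : ℤ) {n : ℕ} (z : Fin n → V) (j : Fin n) :
    extendWord v₀ s z (s + (j : ℕ)) = z j := by
  rw [extendWord, dif_pos ⟨by omega, by omega⟩]
  congr
  omega

lemma extendWord_cons (v₀ v : V) {s i : ℤ} {n : ℕ} (z : Fin n → V) (h : s < i) :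
    extendWord v₀ s (Fin.cons v z : Fin (n + 1) → V) i = extendWord v₀ (s + 1) z i := by
  by_cases h' : i < s + 1 + n
  · rw [extendWord, extendWord, dif_pos ⟨by omega, by push_cast; omega⟩,
      dif_pos ⟨by omega, by omega⟩]
    have : (⟨(i - s).toNat, by omega⟩ : Fin (n + 1)) =
        Fin.succ ⟨(i - (s + 1)).toNat, by omega⟩ := by
      ext
      simp
      omega
    rw [this, Fin.cons_succ]
  · rw [extendWord, extendWord, dif_neg (by push_cast; omega), dif_neg (by omega)]

lemma extendWord_snoc (v₀ v : V) {s i : ℤ} {n : ℕ} (z : Fin n → V) (h : i < s + n) :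
    extendWord v₀ s (Fin.snoc z v : Fin (n + 1) → V) i = extendWord v₀ s z i := by
  by_cases h' : s ≤ i
  · rw [extendWord, extendWord, dif_pos ⟨by omega, by push_cast; omega⟩,
      dif_pos ⟨by omega, by omega⟩]
    have : (⟨(i - s).toNat, by omega⟩ : Fin (n + 1)) =
        Fin.castSucc ⟨(i - s).toNat, by omega⟩ := rfl
    rw [this, Fin.snoc_castSucc]
  · rw [extendWord, extendWord, dif_neg (by omega), dif_neg (by omega)]

/-- The word of length `n` starting at position `i` of a two-sided sequence. -/
def block (i : ℤ) (n : ℕ) (y : ℤ → V) : Fin n → V := fun j => y (i + (j : ℕ))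

lemma measurable_block [MeasurableSpace V] (i : ℤ) (n : ℕ) :
    Measurable (block i n : (ℤ → V) → Fin n → V) :=
  measurable_pi_lambda _ fun _ => measurable_pi_apply _

variable [Fintype V]

-- Symbols outside the block are summed out one at a time, first at the left end and then at the
-- right, each by one application of consistency.
open Classical in
lemma sum_insertionProb_block {w : V → V → ℝ≥0} (hw : Consistent w) (v₀ : V) (n : ℕ) (s i : ℤ)
    {m : ℕ} (x : Fin m → V) (hs : s ≤ i) (hi : i + m ≤ s + n) :
    ∑ z : Fin n → V, (if block i m (extendWord v₀ s z) = x then insertionProb w z else 0) =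
      insertionProb w x := by
  induction n generalizing s with
  | zero =>
    obtain rfl : m = 0 := by omega
    rw [Fintype.sum_eq_single x fun z hz => absurd (Subsingleton.elim z x) hz,
      if_pos (Subsingleton.elim _ _)]
  | succ n ih =>
    rcases hs.lt_or_eq with hs' | rfl
    · have h (v : V) (z : Fin n → V) :
          block i m (extendWord v₀ s (Fin.cons v z : Fin (n + 1) → V)) =
            block i m (extendWord v₀ (s + 1) z) :=
        funext fun j => extendWord_cons v₀ v z (by omega)
      rw [sum_fin_succ_cons, Finset.sum_comm, ← ih (s + 1) (by omega) (by push_cast at hi; omega)]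
      refine Finset.sum_congr rfl fun z _ => ?_
      simp only [h]
      split_ifs
      · exact ((hw.2 n z).2).symm
      · simp
    · rcases hi.lt_or_eq with hi' | hi'
      · have h (v : V) (z : Fin n → V) :
            block s m (extendWord v₀ s (Fin.snoc z v : Fin (n + 1) → V)) =
              block s m (extendWord v₀ s z) :=
          funext fun j => extendWord_snoc v₀ v z (by push_cast at hi'; omega)
        rw [sum_fin_succ_snoc, ← ih s le_rfl (by push_cast at hi'; omega)]
        refine Finset.sum_congr rfl fun z _ => ?_
        simp only [h]
        split_ifs
        · exact ((hw.2 n z).1).symm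
        · simp
      · obtain rfl : m = n + 1 := by omega
        have h (z : Fin (n + 1) → V) : block s (n + 1) (extendWord v₀ s z) = z :=
          funext fun j => extendWord_apply v₀ s z j
        simp only [h, Finset.sum_ite_eq', Finset.mem_univ, if_true]

variable [MeasurableSpace V] [DiscreteMeasurableSpace V]

/-- The law of a two-sided sequence whose coordinates in `[-N, N)` follow the insertion
distribution and whose other coordinates are constant. -/
noncomputable def windowMeasure (w : V → V → ℝ≥0) (v₀ : V) (N : ℕ) : Measure (ℤ → V) :=
  ∑ z : Fin (2 * N) → V, insertionProb w z • Measure.dirac (extendWord v₀ (-N) z)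

lemma measurableSet_block (i : ℤ) {m : ℕ} (x : Fin m → V) :
    MeasurableSet {y : ℤ → V | block i m y = x} :=
  measurable_block i m (measurableSet_singleton x)

lemma windowMeasure_block {w : V → V → ℝ≥0} (hw : Consistent w) (v₀ : V) (N : ℕ) (i : ℤ) {m : ℕ}
    (x : Fin m → V) (hs : -(N : ℤ) ≤ i) (hi : i + m ≤ N) :
    windowMeasure w v₀ N {y | block i m y = x} = insertionProb w x := by
  classical
  rw [← sum_insertionProb_block hw v₀ (2 * N) (-N) i x hs (by push_cast; omega), windowMeasure,
    Measure.finsetSum_apply, ENNReal.ofNNReal_finsetSum]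
  refine Finset.sum_congr rfl fun z _ => ?_
  rw [Measure.smul_apply, Measure.dirac_apply' _ (measurableSet_block i x)]
  by_cases h : block i m (extendWord v₀ (-N) z) = x
  · simp [h, ENNReal.smul_def]
  · simp [h]

lemma isProbabilityMeasure_windowMeasure {w : V → V → ℝ≥0} (hw : Consistent w) (v₀ : V) (N : ℕ) :
    IsProbabilityMeasure (windowMeasure w v₀ N) := by
  -- The event for the empty block is the whole space, so its probability is the total mass.
  have h := windowMeasure_block hw v₀ N 0 (m := 0) Fin.elim0 (by omega) (by simp)
  have hP : insertionProb w (Fin.elim0 : Fin 0 → V) = 1 := by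
    have : totalCount w 0 = 1 := by simp [totalCount]
    simp [insertionProb, this]
  have hS : {y : ℤ → V | block 0 0 y = Fin.elim0} = Set.univ :=
    Set.eq_univ_of_forall fun y => Subsingleton.elim (α := Fin 0 → V) _ _
  rw [hP, hS, ENNReal.coe_one] at h
  exact ⟨h⟩

/-- The insertion process exists when the insertion algorithm is consistent. -/
lemma exists_isInsertionProcess {w : V → V → ℝ≥0} (hw : Consistent w) :
    ∃ μ : Measure (ℤ → V), IsInsertionProcess w μ := by
  have hV : Nonempty V := by
    by_contra hV
    rw [not_nonempty_iff] at hV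
    have := hw.1 1
    simp [totalCount] at this
  obtain ⟨v₀⟩ := hV
  let _ : TopologicalSpace V := ⊥
  have : DiscreteTopology V := ⟨rfl⟩
  let ν (N : ℕ) : ProbabilityMeasure (ℤ → V) :=
    ⟨windowMeasure w v₀ N, isProbabilityMeasure_windowMeasure hw v₀ N⟩
  -- Compactness of the space of probability measures on the compact space `ℤ → V` gives a limit
  -- along an ultrafilter, in place of a convergent subsequence.
  let U : Ultrafilter ℕ := Ultrafilter.of atTop
  obtain ⟨μ, -, hμ⟩ := isCompact_univ.ultrafilter_le_nhds (U.map ν) (by simp)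
  refine ⟨μ, inferInstance, fun i m x => ?_⟩
  have hset : {y : ℤ → V | ∀ j : Fin m, y (i + (j : ℕ)) = x j} = {y | block i m y = x} := by
    ext y
    exact funext_iff.symm
  rw [hset]
  have hclopen : IsClopen {y : ℤ → V | block i m y = x} :=
    (isClopen_discrete {x}).preimage (continuous_pi fun j => continuous_apply _)
  -- Cylinder sets are clopen, so their frontier is empty and weak convergence passes to their
  -- measures.
  have hlim := ProbabilityMeasure.tendsto_measure_of_null_frontier_of_tendsto'
    (L := (U : Filter ℕ)) (μs := ν) (μ := μ) hμ (E := {y : ℤ → V | block i m y = x})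
    (by rw [hclopen.frontier_eq]; simp)
  refine tendsto_nhds_unique hlim (tendsto_const_nhds.congr' ?_)
  have hev : ∀ᶠ N : ℕ in atTop, (insertionProb w x : ℝ≥0∞) =
      (ν N : Measure (ℤ → V)) {y : ℤ → V | block i m y = x} := by
    -- From this N on the block lies inside the window, so the sequence is eventually constant.
    filter_upwards [eventually_ge_atTop (i.natAbs + m)] with N hN
    exact (windowMeasure_block hw v₀ N i x (by omega) (by omega)).symm
  exact Ultrafilter.of_le atTop hev

end

/-! ### From factorization to k-dependence -/

section

lemma sum_measureReal_preimage_singleton {Ω α : Type*} [MeasurableSpace Ω] [Fintype α]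
    [MeasurableSpace α] [MeasurableSingletonClass α] {μ : Measure Ω} [IsProbabilityMeasure μ]
    {X : Ω → α} (hX : Measurable X) : ∑ a, μ.real (X ⁻¹' {a}) = 1 := by
  have := Measure.isProbabilityMeasure_map hX.aemeasurable (μ := μ)
  have h := sum_measureReal_singleton (μ := μ.map X) Finset.univ
  simp only [map_measureReal_apply hX (measurableSet_singleton _)] at h
  rw [h]
  simp

/-- Two random variables with finitely many values are independent as soon as their joint
probabilities are proportional to the products of the marginal probabilities. -/
lemma indepFun_of_proportional {Ω α β : Type*} [MeasurableSpace Ω] [Fintype α] [Fintype β]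
    [MeasurableSpace α] [MeasurableSingletonClass α] [MeasurableSpace β]
    [MeasurableSingletonClass β] {μ : Measure Ω} [IsProbabilityMeasure μ] {X : Ω → α} {Y : Ω → β}
    (hX : Measurable X) (hY : Measurable Y) {κ : ℝ}
    (h : ∀ a b, μ.real (X ⁻¹' {a} ∩ Y ⁻¹' {b}) =
      κ * (μ.real (X ⁻¹' {a}) * μ.real (Y ⁻¹' {b}))) : IndepFun X Y μ := by
  have hpre (a : α) (b : β) : (fun ω => (X ω, Y ω)) ⁻¹' {(a, b)} = X ⁻¹' {a} ∩ Y ⁻¹' {b} := by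
    ext ω
    simp
  -- Summing the hypothesis over all pairs compares total masses, so the proportionality constant
  -- need not be known in advance.
  have hκ : κ = 1 := by
    have h1 := sum_measureReal_preimage_singleton (μ := μ) (hX.prodMk hY)
    simp only [Fintype.sum_prod_type, hpre, h, ← Finset.mul_sum,
      sum_measureReal_preimage_singleton hY, sum_measureReal_preimage_singleton hX, mul_one] at h1
    exact h1
  rw [indepFun_iff_map_prod_eq_prod_map_map hX.aemeasurable hY.aemeasurable]
  have := Measure.isProbabilityMeasure_map hX.aemeasurable (μ := μ)
  have := Measure.isProbabilityMeasure_map hY.aemeasurable (μ := μ)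
  have := Measure.isProbabilityMeasure_map (hX.prodMk hY).aemeasurable (μ := μ)
  refine Measure.ext_of_singleton fun ⟨a, b⟩ => ?_
  rw [← Set.singleton_prod_singleton, Measure.prod_prod, Set.singleton_prod_singleton,
    Measure.map_apply (hX.prodMk hY) (measurableSet_singleton _), hpre,
    Measure.map_apply hX (measurableSet_singleton _),
    Measure.map_apply hY (measurableSet_singleton _)]
  rw [← ENNReal.toReal_eq_toReal_iff' (by finiteness) (by finiteness), ENNReal.toReal_mul]
  simpa [hκ, Measure.real] using h a b

variable {V : Type*}

lemma block_eq_append_iff {i : ℤ} {m n : ℕ} {x : Fin m → V} {y : Fin n → V} {u : ℤ → V} :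
    block i (m + n) u = Fin.append x y ↔ block i m u = x ∧ block (i + m) n u = y := by
  constructor
  · intro h
    constructor
    · funext j
      simpa [block] using congrFun h (Fin.castAdd n j)
    · funext j
      simpa [block, add_assoc] using congrFun h (Fin.natAdd m j)
  · rintro ⟨rfl, rfl⟩
    funext j
    refine Fin.addCases (fun j => ?_) (fun j => ?_) j <;> simp [block, add_assoc]

lemma IsKDependent.mono [MeasurableSpace V] {μ : Measure (ℤ → V)} {k l : ℕ} (h : IsKDependent k μ) (hkl : k ≤ l) :
    IsKDependent l μ := by
  have hcomp := IndepFun.comp h (φ := id)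
    (ψ := fun (y : {i : ℤ // (k : ℤ) ≤ i} → V) (j : {i : ℤ // (l : ℤ) ≤ i}) =>
      y ⟨j.1, le_trans (by exact_mod_cast hkl) j.2⟩)
    measurable_id (measurable_pi_lambda _ fun _ => measurable_pi_apply _)
  exact hcomp

variable [Fintype V] [MeasurableSpace V]

lemma IsInsertionProcess.measureReal_block {w : V → V → ℝ≥0} {μ : Measure (ℤ → V)}
    (hμ : IsInsertionProcess w μ) (i : ℤ) {n : ℕ} (x : Fin n → V) :
    μ.real (block i n ⁻¹' {x}) = insertionProb w x := by
  have hset : block i n ⁻¹' {x} = {y : ℤ → V | ∀ j : Fin n, y (i + (j : ℕ)) = x j} := by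
    ext y
    exact funext_iff
  rw [Measure.real, hset, hμ.2 i n x, ENNReal.coe_toReal]

variable [DiscreteMeasurableSpace V]

lemma IsInsertionProcess.indepFun_block {w : V → V → ℝ≥0} {μ : Measure (ℤ → V)}
    (hμ : IsInsertionProcess w μ) {k : ℕ} (hk : GapFactorizes w k) (m n : ℕ) :
    IndepFun (block (-m) m) (block k n) μ := by
  have := hμ.1
  obtain ⟨κ, hκ⟩ := hk m n
  refine indepFun_of_proportional (measurable_block _ _) (measurable_block _ _) (κ := κ)
    fun x y => ?_
  rw [hμ.measureReal_block, hμ.measureReal_block, ← hκ]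
  -- The two blocks are separated by the k positions 0, …, k - 1; the event splits according to the
  -- word found there.
  have hset : block (-m) m ⁻¹' {x} ∩ block k n ⁻¹' {y} =
      ⋃ a ∈ (Finset.univ : Finset (Fin k → V)),
        block (-m) (m + k + n) ⁻¹' {Fin.append (Fin.append x a) y} := by
    ext u
    simp only [Set.mem_inter_iff, Set.mem_preimage, Set.mem_singleton_iff, Set.mem_iUnion,
      Finset.mem_univ, exists_true_left, block_eq_append_iff]
    push_cast
    simp
  rw [hset, measureReal_biUnion_finset]
  · simp only [hμ.measureReal_block]
  · intro a _ b _ hab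
    refine Set.disjoint_left.2 fun u hu hv => hab ?_
    simp only [Set.mem_preimage, Set.mem_singleton_iff, block_eq_append_iff] at hu hv
    exact hu.1.2.symm.trans hv.1.2
  · exact fun a _ => measurableSet_block _ _

/-- Independence of the two half-line processes reduces to finite sets of indices, and any such sets
lie in one block ending at -1 and one block starting at k. -/
lemma IsInsertionProcess.isKDependent {w : V → V → ℝ≥0} {μ : Measure (ℤ → V)}
    (hμ : IsInsertionProcess w μ) {k : ℕ} (hk : GapFactorizes w k) : IsKDependent k μ := by
  have := hμ.1
  refine IndepFun.process_indepFun_process (fun i => measurable_pi_apply _)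
    (fun i => measurable_pi_apply _) fun I J => ?_
  obtain ⟨m, hm⟩ : ∃ m : ℕ, ∀ i ∈ I, i.1.natAbs ≤ m :=
    ⟨I.sup fun i => i.1.natAbs, fun i hi => Finset.le_sup (f := fun i => i.1.natAbs) hi⟩
  obtain ⟨n, hn⟩ : ∃ n : ℕ, ∀ i ∈ J, i.1.natAbs < n :=
    ⟨(J.sup fun i => i.1.natAbs) + 1, fun i hi =>
      Nat.lt_succ_of_le (Finset.le_sup (f := fun i => i.1.natAbs) hi)⟩
  have h := (hμ.indepFun_block hk m n).comp
    (φ := fun (x : Fin m → V) (i : I) => x ⟨(i.1.1 + m).toNat, by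
      have := hm i.1 i.2
      have := i.1.2
      omega⟩)
    (ψ := fun (y : Fin n → V) (j : J) => y ⟨(j.1.1 - k).toNat, by
      have := hn j.1 j.2
      have := j.1.2
      omega⟩)
    (measurable_of_finite _) (measurable_of_finite _)
  convert h using 1
  · funext y i
    have := hm i.1 i.2
    have := i.1.2
    simp only [Function.comp, block]
    congr 1
    omega
  · funext y j
    have := j.1.2
    simp only [Function.comp, block]
    congr 1
    omega

end

/-! ### Consistency forces constant weights -/

section

variable {V : Type*}

lemma buildingCount_one (w : V → V → ℝ≥0) (x : Fin 1 → V) : buildingCount w x = 1 := by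
  rw [buildingCount_succ, Fin.sum_univ_one, buildingCount_zero, mul_one]
  exact one_mul 1

lemma buildingCount_two (w : V → V → ℝ≥0) (x : Fin 2 → V) :
    buildingCount w x = 2 * w (x 0) (x 1) := by
  rw [buildingCount_succ, Fin.sum_univ_two, buildingCount_one, buildingCount_one]
  -- One summand for each position of the last arrival, with the missing outer edge at each end read
  -- as 1.
  change 1 * w (x 0) (x 1) * 1 + w (x 0) (x 1) * 1 * 1 = _
  ring

lemma buildingCount_three (w : V → V → ℝ≥0) (x : Fin 3 → V) :
    buildingCount w x = 2 * (w (x 0) (x 1) * w (x 1) (x 2)) * (2 + w (x 0) (x 2)) := by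
  rw [buildingCount_succ, Fin.sum_univ_three, buildingCount_two, buildingCount_two,
    buildingCount_two]
  change 1 * w (x 0) (x 1) * (2 * w (x 1) (x 2)) +
    w (x 0) (x 1) * w (x 1) (x 2) * (2 * w (x 0) (x 2)) +
    w (x 1) (x 2) * 1 * (2 * w (x 0) (x 1)) = _
  ring

lemma buildingCount_four (w : V → V → ℝ≥0) (x : Fin 4 → V) :
    buildingCount w x = 2 * (w (x 0) (x 1) * w (x 1) (x 2) * w (x 2) (x 3)) *
      (4 + 3 * w (x 1) (x 3) + 3 * w (x 0) (x 2) + w (x 0) (x 2) * w (x 0) (x 3) +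
        w (x 1) (x 3) * w (x 0) (x 3)) := by
  rw [buildingCount_succ, Fin.sum_univ_four, buildingCount_three, buildingCount_three,
    buildingCount_three, buildingCount_three]
  change 1 * w (x 0) (x 1) * (2 * (w (x 1) (x 2) * w (x 2) (x 3)) * (2 + w (x 1) (x 3))) +
    w (x 0) (x 1) * w (x 1) (x 2) *
      (2 * (w (x 0) (x 2) * w (x 2) (x 3)) * (2 + w (x 0) (x 3))) +
    w (x 1) (x 2) * w (x 2) (x 3) *
      (2 * (w (x 0) (x 1) * w (x 1) (x 3)) * (2 + w (x 0) (x 3))) +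
    w (x 2) (x 3) * 1 * (2 * (w (x 0) (x 1) * w (x 1) (x 2)) * (2 + w (x 0) (x 2))) = _
  ring

variable [Fintype V]

lemma Consistent.exists_sum_buildingCount {w : V → V → ℝ≥0} (hw : Consistent w) (n : ℕ) :
    ∃ C : ℝ, ∀ x : Fin n → V,
      ∑ v : V, (buildingCount w (Fin.snoc x v : Fin (n + 1) → V) : ℝ) = C * buildingCount w x ∧
      ∑ v : V, (buildingCount w (Fin.cons v x : Fin (n + 1) → V) : ℝ) = C * buildingCount w x := by
  have h1 := (NNReal.coe_pos.2 (hw.1 n)).ne'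
  have h2 := (NNReal.coe_pos.2 (hw.1 (n + 1))).ne'
  refine ⟨totalCount w (n + 1) / totalCount w n, fun x => ?_⟩
  obtain ⟨ha, hb⟩ := hw.2 n x
  simp only [insertionProb, ← NNReal.coe_inj, NNReal.coe_sum, NNReal.coe_div,
    ← Finset.sum_div] at ha hb
  constructor
  · rw [eq_div_iff h2] at ha
    rw [← ha]
    ring
  · rw [eq_div_iff h2] at hb
    rw [← hb]
    ring

lemma Consistent.two_le_card {w : V → V → ℝ≥0} (hw : Consistent w) (h0 : ∀ i, w i i = 0) :
    2 ≤ Fintype.card V := by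
  by_contra h
  have hV : Subsingleton V := Fintype.card_le_one_iff_subsingleton.1 (by omega)
  refine (hw.1 2).ne' (Finset.sum_eq_zero fun x _ => ?_)
  rw [buildingCount_two, Subsingleton.elim (x 0) (x 1), h0, mul_zero]

/-- The relations between edge weights expressing consistency for words of length at most four. -/
structure EdgeRelations (W : V → V → ℝ) (s t α β : ℝ) : Prop where
  row_sum : ∀ a, ∑ d, W a d = s
  col_sum : ∀ a, ∑ d, W d a = s
  row_inner : ∀ a b, a ≠ b → ∑ d, W a d * W b d = t
  col_inner : ∀ a b, a ≠ b → ∑ d, W d a * W d b = t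
  row_triple : ∀ a b c, a ≠ b → b ≠ c → ∑ d, W a d * W b d * W c d = α + β * W a c
  coeff : α = 2 * β + 2 * s - t

/-- Consistency says that summing B over an added symbol multiplies B by a constant depending only
on the length. Inserting the explicit counts up to length four and cancelling the positive edges of
the word gives the relations. Since α and β come from the same constant C₃, eliminating it yields
`coeff`. -/
lemma Consistent.exists_edgeRelations {w : V → V → ℝ≥0} (hw : Consistent w)
    (h0 : ∀ i, w i i = 0) (hpos : ∀ i j, i ≠ j → 0 < w i j) :
    ∃ s t α β, EdgeRelations (fun i j => (w i j : ℝ)) s t α β := by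
  obtain ⟨C₁, hC₁⟩ := hw.exists_sum_buildingCount 1
  obtain ⟨C₂, hC₂⟩ := hw.exists_sum_buildingCount 2
  obtain ⟨C₃, hC₃⟩ := hw.exists_sum_buildingCount 3
  have hne (a b : V) (h : a ≠ b) : (w a b : ℝ) ≠ 0 := (NNReal.coe_pos.2 (hpos a b h)).ne'
  have row (a : V) : ∑ d, (w a d : ℝ) = C₁ / 2 := by
    have h : ∑ d, (2 * w a d : ℝ) = C₁ := by
      simpa [buildingCount_two, buildingCount_one, Fin.snoc] using (hC₁ ![a]).1
    rw [← h, ← Finset.mul_sum]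
    ring
  have col (a : V) : ∑ d, (w d a : ℝ) = C₁ / 2 := by
    have h : ∑ d, (2 * w d a : ℝ) = C₁ := by
      simpa [buildingCount_two, buildingCount_one] using (hC₁ ![a]).2
    rw [← h, ← Finset.mul_sum]
    ring
  have rowInner (a b : V) (hab : a ≠ b) : ∑ d, (w a d * w b d : ℝ) = C₂ - C₁ := by
    have h : ∑ d, (2 * (w a b * w b d) * (2 + w a d) : ℝ) = C₂ * (2 * w a b) := by
      have := (hC₂ ![a, b]).1
      simp only [buildingCount_two, buildingCount_three] at this
      push_cast at this
      exact this
    have h' : ∑ d, (2 * (w a b * w b d) * (2 + w a d) : ℝ) =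
        2 * w a b * (2 * ∑ d, (w b d : ℝ) + ∑ d, (w a d * w b d : ℝ)) := by
      simp only [Finset.mul_sum, ← Finset.sum_add_distrib]
      exact Finset.sum_congr rfl fun d _ => by ring
    rw [h', row] at h
    have := mul_left_cancel₀ (hne a b hab) (b := 2 * (C₁ / 2) + ∑ d, (w a d * w b d : ℝ))
      (c := C₂) (by linarith)
    linarith
  have colInner (a b : V) (hab : a ≠ b) : ∑ d, (w d a * w d b : ℝ) = C₂ - C₁ := by
    have h : ∑ d, (2 * (w d a * w a b) * (2 + w d b) : ℝ) = C₂ * (2 * w a b) := by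
      have := (hC₂ ![a, b]).2
      simp only [buildingCount_two, buildingCount_three] at this
      push_cast at this
      exact this
    have h' : ∑ d, (2 * (w d a * w a b) * (2 + w d b) : ℝ) =
        2 * w a b * (2 * ∑ d, (w d a : ℝ) + ∑ d, (w d a * w d b : ℝ)) := by
      simp only [Finset.mul_sum, ← Finset.sum_add_distrib]
      exact Finset.sum_congr rfl fun d _ => by ring
    rw [h', col] at h
    have := mul_left_cancel₀ (hne a b hab) (b := 2 * (C₁ / 2) + ∑ d, (w d a * w d b : ℝ))
      (c := C₂) (by linarith)
    linarith
  refine ⟨C₁ / 2, C₂ - C₁, 2 * C₃ - 4 * (C₁ / 2) - 3 * (C₂ - C₁), C₃ - 3 * (C₁ / 2) - (C₂ - C₁),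
    row, col, rowInner, colInner, fun a b c hab hbc => ?_, by ring⟩
  have h : ∑ d, (2 * (w a b * w b c * w c d) *
      (4 + 3 * w b d + 3 * w a c + w a c * w a d + w b d * w a d) : ℝ) =
      C₃ * (2 * (w a b * w b c) * (2 + w a c)) := by
    have := (hC₃ ![a, b, c]).1
    simp only [buildingCount_three, buildingCount_four] at this
    push_cast at this
    exact this
  have h' : ∑ d, (2 * (w a b * w b c * w c d) *
      (4 + 3 * w b d + 3 * w a c + w a c * w a d + w b d * w a d) : ℝ) =
      w a b * w b c * (2 * ((4 + 3 * w a c) * ∑ d, (w c d : ℝ) + 3 * ∑ d, (w b d * w c d : ℝ) +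
        w a c * ∑ d, (w a d * w c d : ℝ) + ∑ d, (w a d * w b d * w c d : ℝ))) := by
    simp only [Finset.mul_sum, ← Finset.sum_add_distrib]
    exact Finset.sum_congr rfl fun d _ => by ring
  -- For a = c the sum is a squared norm not governed by `rowInner`, but its coefficient `w a a` is
  -- 0. Allowing a = c is needed later.
  have hac : (w a c : ℝ) * ∑ d, (w a d * w c d : ℝ) = w a c * (C₂ - C₁) := by
    rcases eq_or_ne a c with rfl | hac
    · simp [h0]
    · rw [rowInner a c hac]
  rw [h', row, rowInner b c hbc, hac] at h
  have := mul_left_cancel₀ (mul_ne_zero (hne a b hab) (hne b c hbc))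
    (b := 2 * ((4 + 3 * w a c) * (C₁ / 2) + 3 * (C₂ - C₁) + w a c * (C₂ - C₁) +
      ∑ d, (w a d * w b d * w c d : ℝ))) (c := 2 * C₃ * (2 + w a c)) (by linarith)
  linarith

section

variable {W : V → V → ℝ} {s t α β : ℝ}

/-- If β = 0, W maps each vector v = (W a d · W b d)_d with a ≠ b to the constant vector α. Applying
the transpose of W, whose product with W has all off-diagonal entries t, determines the column
norms. All columns then have squared norm and pairwise inner product t, hence coincide, against the
zero diagonal. -/
lemma EdgeRelations.beta_ne_zero (hW : EdgeRelations W s t α β) (h0 : ∀ i, W i i = 0)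
    (hpos : ∀ i j, i ≠ j → 0 < W i j) (hV : 3 ≤ Fintype.card V) : β ≠ 0 := by
  classical
  intro hβ
  have htriple (a b c : V) (hab : a ≠ b) : ∑ d, W c d * (W a d * W b d) = α := by
    by_cases hbc : b = c
    · subst hbc
      have := hW.row_triple b a b hab.symm hab
      rw [hβ, zero_mul, add_zero] at this
      rw [← this]
      exact Finset.sum_congr rfl fun d _ => by ring
    · have := hW.row_triple a b c hab hbc
      rw [hβ, zero_mul, add_zero] at this
      rw [← this]
      exact Finset.sum_congr rfl fun d _ => by ring
  -- This is the entry at e of WᵀWv, computed in two ways. At e = a the entry v_e vanishes, giving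
  -- t² = αs; at e different from a and b it is positive, which forces the squared norm of column e
  -- to be t.
  have hgram (a b e : V) (hab : a ≠ b) :
      (∑ c, W c e * W c e - t) * (W a e * W b e) + t * t = α * s := by
    have h1 : ∑ c, W c e * ∑ d, W c d * (W a d * W b d) = α * s := by
      simp only [htriple a b _ hab, ← Finset.sum_mul, hW.col_sum e]
      ring
    have h2 : ∑ c, W c e * ∑ d, W c d * (W a d * W b d) =
        ∑ d, (∑ c, W c e * W c d) * (W a d * W b d) := by
      simp only [Finset.mul_sum, Finset.sum_mul]
      rw [Finset.sum_comm]
      exact Finset.sum_congr rfl fun d _ => Finset.sum_congr rfl fun c _ => by ring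
    have h3 (d : V) : (∑ c, W c e * W c d) * (W a d * W b d) = t * (W a d * W b d) +
        if d = e then (∑ c, W c e * W c e - t) * (W a e * W b e) else 0 := by
      split_ifs with hde
      · subst hde
        ring
      · rw [hW.col_inner e d (Ne.symm hde), add_zero]
    rw [← h1, h2, Finset.sum_congr rfl fun d _ => h3 d, Finset.sum_add_distrib,
      Finset.sum_ite_eq', ← Finset.mul_sum, hW.row_inner a b hab]
    simp
    ring
  have hnorm (e : V) : ∑ c, W c e * W c e = t := by
    obtain ⟨a, ha, b, hb, hab⟩ := Finset.one_lt_card.1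
      (show 1 < (Finset.univ.erase e).card by
        rw [Finset.card_erase_of_mem (Finset.mem_univ e), Finset.card_univ]
        omega)
    have h1 := hgram a b a hab
    have h2 := hgram a b e hab
    rw [h0, zero_mul, mul_zero, zero_add] at h1
    have h3 : (∑ c, W c e * W c e - t) * (W a e * W b e) = 0 := by linarith
    have h4 : W a e * W b e ≠ 0 :=
      (mul_pos (hpos _ _ (Finset.ne_of_mem_erase ha)) (hpos _ _ (Finset.ne_of_mem_erase hb))).ne'
    linarith [(mul_eq_zero.1 h3).resolve_right h4]
  obtain ⟨a, b, hab⟩ := Fintype.one_lt_card_iff.1 (show 1 < Fintype.card V by omega)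
  have hsq : ∑ c, (W c a - W c b) ^ 2 = 0 := by
    have h (c : V) : (W c a - W c b) ^ 2 =
        W c a * W c a - 2 * (W c a * W c b) + W c b * W c b := by ring
    simp only [h, Finset.sum_add_distrib, Finset.sum_sub_distrib, ← Finset.mul_sum, hnorm,
      hW.col_inner a b hab]
    ring
  have h := (Finset.sum_eq_zero_iff_of_nonneg fun c _ => sq_nonneg _).1 hsq a (Finset.mem_univ a)
  rw [h0] at h
  have := hpos a b hab
  nlinarith

/-- The triple sum is symmetric in a, b, c, whereas α + βW(a,c) distinguishes its middle index.
Since β ≠ 0, exchanging a and b makes columns constant off the diagonal, and exchanging a and c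
makes W symmetric; the latter needs a third vertex b. -/
lemma EdgeRelations.exists_const (hW : EdgeRelations W s t α β) (h0 : ∀ i, W i i = 0)
    (hpos : ∀ i j, i ≠ j → 0 < W i j) (hV : 3 ≤ Fintype.card V) :
    ∃ c, 0 < c ∧ ∀ i j, i ≠ j → W i j = c := by
  classical
  have hβ := hW.beta_ne_zero h0 hpos hV
  have hcol (a b c : V) (hac : a ≠ c) (hbc : b ≠ c) : W a c = W b c := by
    rcases eq_or_ne a b with rfl | hab
    · rfl
    have h1 := hW.row_triple a b c hab hbc
    have h2 := hW.row_triple b a c hab.symm hac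
    have h3 : ∑ d, W a d * W b d * W c d = ∑ d, W b d * W a d * W c d :=
      Finset.sum_congr rfl fun d _ => by ring
    exact mul_left_cancel₀ hβ (by linarith)
  have hsymm (a c : V) (hac : a ≠ c) : W a c = W c a := by
    obtain ⟨b, hb⟩ := Finset.card_pos.1 (show 0 < ((Finset.univ.erase a).erase c).card by
      rw [Finset.card_erase_of_mem (by simp [hac.symm]),
        Finset.card_erase_of_mem (Finset.mem_univ a), Finset.card_univ]
      omega)
    simp only [Finset.mem_erase, Finset.mem_univ, and_true] at hb
    have h1 := hW.row_triple a b c hb.2.symm hb.1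
    have h2 := hW.row_triple c b a hb.1.symm hb.2
    have h3 : ∑ d, W a d * W b d * W c d = ∑ d, W c d * W b d * W a d :=
      Finset.sum_congr rfl fun d _ => by ring
    exact mul_left_cancel₀ hβ (by linarith)
  obtain ⟨u, v, huv⟩ := Fintype.one_lt_card_iff.1 (show 1 < Fintype.card V by omega)
  refine ⟨W u v, hpos u v huv, fun a b hab => ?_⟩
  rcases eq_or_ne b v with rfl | hbv
  · exact hcol a u b hab huv
  · rw [hcol a v b hab hbv.symm, hsymm v b hbv.symm, hcol b u v hbv huv]

/-- With constant weight c one finds s = c(q - 1), t = c²(q - 2), α = c³(q - 2) and β = -c². Then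
`coeff` becomes c(c - 1)((q - 2)c + 2(q - 1)) = 0, whose last factor is positive. -/
lemma EdgeRelations.const_eq_one (hW : EdgeRelations W s t α β) (h0 : ∀ i, W i i = 0)
    (hV : 3 ≤ Fintype.card V) {c : ℝ} (hc : 0 < c) (hWc : ∀ i j, i ≠ j → W i j = c) : c = 1 := by
  classical
  obtain ⟨a, b, d, hab, had, hbd⟩ := Fintype.two_lt_card_iff.1 (show 2 < Fintype.card V by omega)
  have hite (x y : V) : W x y = c - if y = x then c else 0 := by
    split_ifs with h
    · rw [h, h0, sub_self]
    · rw [hWc x y (Ne.symm h), sub_zero]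
  have hsum (F : V → ℝ) (x : V) : ∑ y, F y * W x y = c * ∑ y, F y - F x * c := by
    simp only [hite x, mul_sub, Finset.sum_sub_distrib, mul_ite, mul_zero, Finset.sum_ite_eq',
      Finset.mem_univ, if_true, Finset.sum_mul, mul_comm c]
  have hs : s = c * Fintype.card V - c := by
    have := hsum (fun _ => 1) a
    simpa [hW.row_sum] using this
  have ht : t = c * s - c * c := by
    have := hsum (W a) b
    rwa [hW.row_inner a b hab, hW.row_sum, hWc a b hab] at this
  have h1 : α = c * t := by
    have := hsum (fun y => W a y * W b y) a
    rw [hW.row_triple a b a hab hab.symm, hW.row_inner a b hab, h0] at this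
    linarith
  have h2 : α + β * c = c * t - c * c * c := by
    have := hsum (fun y => W a y * W b y) d
    rwa [hW.row_triple a b d hab hbd, hW.row_inner a b hab, hWc a d had, hWc b d hbd] at this
  have hβ : β = - (c * c) := mul_right_cancel₀ hc.ne' (by linarith)
  have h3 := hW.coeff
  have hq : (3 : ℝ) ≤ Fintype.card V := by exact_mod_cast hV
  rw [h1, hβ, ht, hs] at h3
  have h4 : c * ((c - 1) * ((Fintype.card V - 2) * c + 2 * (Fintype.card V - 1))) = 0 := by
    linear_combination h3
  have h5 : (0 : ℝ) < (Fintype.card V - 2) * c + 2 * (Fintype.card V - 1) := by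
    have : (0 : ℝ) < (Fintype.card V - 2) * c := mul_pos (by linarith) hc
    linarith
  have h6 := (mul_eq_zero.1 ((mul_eq_zero.1 h4).resolve_left hc.ne')).resolve_right h5.ne'
  linarith

end

/-- A consistent insertion algorithm on a loopless complete weighted graph has constant weights,
equal to `1` when there are at least three vertices. -/
lemma Consistent.exists_const {w : V → V → ℝ≥0} (hw : Consistent w) (h0 : ∀ i, w i i = 0)
    (hpos : ∀ i j, i ≠ j → 0 < w i j) :
    ∃ c : ℝ, 0 < c ∧ (∀ i j, i ≠ j → (w i j : ℝ) = c) ∧ (3 ≤ Fintype.card V → c = 1) := by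
  classical
  obtain ⟨s, t, α, β, hW⟩ := hw.exists_edgeRelations h0 hpos
  have h0' (i : V) : (w i i : ℝ) = 0 := by rw [h0, NNReal.coe_zero]
  have hpos' (i j : V) (h : i ≠ j) : 0 < (w i j : ℝ) := NNReal.coe_pos.2 (hpos i j h)
  by_cases hV : 3 ≤ Fintype.card V
  · obtain ⟨c, hc, hWc⟩ := hW.exists_const h0' hpos' hV
    exact ⟨c, hc, hWc, fun _ => hW.const_eq_one h0' hV hc hWc⟩
  · have hcard : Fintype.card V = 2 := by
      have := hw.two_le_card h0
      omega
    have hrow (a b : V) (hab : a ≠ b) : (w a b : ℝ) = s := by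
      have huniv : ({a, b} : Finset V) = Finset.univ :=
        Finset.eq_univ_of_card _ (by rw [Finset.card_pair hab, hcard])
      have := hW.row_sum a
      rw [← huniv, Finset.sum_pair hab, h0', zero_add] at this
      exact this
    obtain ⟨a, b, hab⟩ := Fintype.one_lt_card_iff.1 (show 1 < Fintype.card V by omega)
    exact ⟨s, hrow a b hab ▸ hpos' a b hab, hrow, fun h => absurd h hV⟩

end

/-! ### End-point correlations as an obstruction -/

section

variable {V : Type*}

lemma coe_weight_eq [DecidableEq V] {w : V → V → ℝ≥0} {c : ℝ} (h0 : ∀ i, w i i = 0)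
    (hc : ∀ i j, i ≠ j → (w i j : ℝ) = c) (i j : V) :
    (w i j : ℝ) = c - if j = i then c else 0 := by
  split_ifs with h
  · rw [h, h0, NNReal.coe_zero, sub_self]
  · rw [hc i j (Ne.symm h), sub_zero]

lemma IsUnweightedComplete.weight_self {w : V → V → ℝ≥0} {q : ℕ} (h : IsUnweightedComplete q w)
    (i : V) : w i i = 0 := by
  obtain ⟨e, he⟩ := h
  simp [he]

lemma IsUnweightedComplete.weight_of_ne {w : V → V → ℝ≥0} {q : ℕ} (h : IsUnweightedComplete q w)
    (i j : V) (hij : i ≠ j) : w i j = 1 := by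
  obtain ⟨e, he⟩ := h
  simp [he, hij]

variable [Fintype V]

lemma isUnweightedComplete_of_card {w : V → V → ℝ≥0} (h0 : ∀ i, w i i = 0)
    (h1 : ∀ i j, i ≠ j → w i j = 1) {q : ℕ} (hq : Fintype.card V = q) :
    IsUnweightedComplete q w := by
  refine ⟨Fintype.equivFinOfCardEq hq, fun i j => ?_⟩
  split_ifs with h
  · rw [(Fintype.equivFinOfCardEq hq).injective h, h0]
  · exact h1 i j fun hij => h (congrArg _ hij)

lemma IsUnweightedComplete.card_eq {w : V → V → ℝ≥0} {q : ℕ} (h : IsUnweightedComplete q w) :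
    Fintype.card V = q := by
  obtain ⟨e, -⟩ := h
  simpa using Fintype.card_congr e

/-- The sum over all words of length `n + 1` of the building count, weighted by the values of `f`
at both end points. -/
noncomputable def endSum (w : V → V → ℝ≥0) (f : V → ℝ) (n : ℕ) : ℝ :=
  ∑ x : Fin (n + 1) → V, f (x 0) * f (x (Fin.last n)) * buildingCount w x

lemma endSum_zero (w : V → V → ℝ≥0) (f : V → ℝ) : endSum w f 0 = ∑ v, f v * f v := by
  simp [endSum, buildingCount_one, sum_fin_succ_cons]

lemma sum_insertNth {M : Type*} [AddCommMonoid M] {n : ℕ} (i : Fin (n + 1))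
    (F : (Fin (n + 1) → V) → M) :
    ∑ z, F z = ∑ x : Fin n → V, ∑ v : V, F (i.insertNth v x : Fin (n + 1) → V) := by
  rw [← (Fin.insertNthEquiv (fun _ : Fin (n + 1) => V) i).sum_comp, Fintype.sum_prod_type,
    Finset.sum_comm]
  rfl

lemma sum_mul_weight_left {w : V → V → ℝ≥0} {c : ℝ} {f : V → ℝ}
    (h0 : ∀ i, w i i = 0) (hc : ∀ i j, i ≠ j → (w i j : ℝ) = c) (hf : ∑ v, f v = 0)
    (u : V) : ∑ v, f v * (w u v : ℝ) = -c * f u := by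
  classical
  simp only [coe_weight_eq h0 hc, mul_sub, Finset.sum_sub_distrib, ← Finset.sum_mul, hf, mul_ite,
    mul_zero, Finset.sum_ite_eq', Finset.mem_univ, if_true]
  ring

lemma sum_mul_weight_right {w : V → V → ℝ≥0} {c : ℝ} {f : V → ℝ}
    (h0 : ∀ i, w i i = 0) (hc : ∀ i j, i ≠ j → (w i j : ℝ) = c) (hf : ∑ v, f v = 0)
    (u : V) : ∑ v, f v * (w v u : ℝ) = -c * f u := by
  classical
  simp only [coe_weight_eq h0 hc, mul_sub, Finset.sum_sub_distrib, ← Finset.sum_mul, hf, mul_ite,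
    mul_zero, Finset.sum_ite_eq, Finset.mem_univ, if_true]
  ring

lemma sum_weight_mul_weight {w : V → V → ℝ≥0} {c : ℝ}
    (h0 : ∀ i, w i i = 0) (hc : ∀ i j, i ≠ j → (w i j : ℝ) = c)
    {a b : V} (hab : a ≠ b) :
    ∑ v, (w a v : ℝ) * (w v b : ℝ) = c ^ 2 * (Fintype.card V - 2) := by
  classical
  have h (v : V) : (w a v : ℝ) * (w v b : ℝ) =
      c ^ 2 - (if v = a then c ^ 2 else 0) - (if v = b then c ^ 2 else 0) := by
    rcases eq_or_ne v a with rfl | ha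
    · simp [h0, hab]
    · rcases eq_or_ne v b with rfl | hb
      · simp [h0, ha]
      · rw [hc a v ha.symm, hc v b hb, if_neg ha, if_neg hb]
        ring
  simp only [h, Finset.sum_sub_distrib, Finset.sum_ite_eq', Finset.mem_univ, if_true,
    Finset.sum_const, Finset.card_univ, nsmul_eq_mul]
  ring

/-- Condition on the position of the last arrival. At either end, f is an eigenvector of the weights
with eigenvalue -c because it sums to zero; in each of the n interior gaps, summing the new symbol
out gives c²(q - 2). -/
lemma endSum_succ {w : V → V → ℝ≥0} {c : ℝ} {f : V → ℝ}
    (h0 : ∀ i, w i i = 0) (hc : ∀ i j, i ≠ j → (w i j : ℝ) = c) (hf : ∑ v, f v = 0)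
    (n : ℕ) :
    endSum w f (n + 1) = (-(2 * c) + n * (c ^ 2 * (Fintype.card V - 2))) * endSum w f n := by
  have expand : endSum w f (n + 1) = ∑ i : Fin (n + 2), ∑ x : Fin (n + 1) → V, ∑ v : V,
      f ((i.insertNth v x : Fin (n + 2) → V) 0) *
        f ((i.insertNth v x : Fin (n + 2) → V) (Fin.last (n + 1))) *
        (leftEdge w (i.insertNth v x : Fin (n + 2) → V) i *
          rightEdge w (i.insertNth v x : Fin (n + 2) → V) i * buildingCount w x) := by
    simp only [endSum, buildingCount_succ w (n := n + 1), NNReal.coe_sum, Finset.mul_sum]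
    rw [Finset.sum_comm]
    refine Finset.sum_congr rfl fun i _ => ?_
    rw [sum_insertNth i]
    simp
  have first : ∑ x : Fin (n + 1) → V, ∑ v : V,
      f ((Fin.insertNth 0 v x : Fin (n + 2) → V) 0) *
        f ((Fin.insertNth 0 v x : Fin (n + 2) → V) (Fin.last (n + 1))) *
        (leftEdge w (Fin.insertNth 0 v x : Fin (n + 2) → V) 0 *
          rightEdge w (Fin.insertNth 0 v x : Fin (n + 2) → V) 0 * buildingCount w x) =
      -c * endSum w f n := by
    rw [endSum, Finset.mul_sum]
    refine Finset.sum_congr rfl fun x _ => ?_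
    have hr (v : V) : rightEdge w (Fin.cons v x : Fin (n + 2) → V) 0 = w v (x 0) :=
      rightEdge_castSucc w (Fin.cons v x : Fin (n + 2) → V) 0
    have hlast (v : V) : (Fin.cons v x : Fin (n + 2) → V) (Fin.last (n + 1)) = x (Fin.last n) := by
      rw [← Fin.succ_last, Fin.cons_succ]
    simp only [Fin.insertNth_zero', hr, hlast, leftEdge_zero, Fin.cons_zero, NNReal.coe_one,
      one_mul]
    calc _ = (∑ v, f v * (w v (x 0) : ℝ)) * (f (x (Fin.last n)) * buildingCount w x) := by
          rw [Finset.sum_mul]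
          exact Finset.sum_congr rfl fun v _ => by ring
      _ = _ := by
          rw [sum_mul_weight_right h0 hc hf]
          ring
  have last : ∑ x : Fin (n + 1) → V, ∑ v : V,
      f (((Fin.last (n + 1)).insertNth v x : Fin (n + 2) → V) 0) *
        f (((Fin.last (n + 1)).insertNth v x : Fin (n + 2) → V) (Fin.last (n + 1))) *
        (leftEdge w ((Fin.last (n + 1)).insertNth v x : Fin (n + 2) → V) (Fin.last (n + 1)) *
          rightEdge w ((Fin.last (n + 1)).insertNth v x : Fin (n + 2) → V) (Fin.last (n + 1)) *
          buildingCount w x) =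
      -c * endSum w f n := by
    rw [endSum, Finset.mul_sum]
    refine Finset.sum_congr rfl fun x _ => ?_
    have hl (v : V) : leftEdge w (Fin.snoc x v : Fin (n + 2) → V) (Fin.last (n + 1)) =
        w (x (Fin.last n)) v := by
      rw [← Fin.succ_last, leftEdge_succ, Fin.snoc_castSucc, Fin.succ_last, Fin.snoc_last]
    have hfirst (v : V) : (Fin.snoc x v : Fin (n + 2) → V) 0 = x 0 :=
      Fin.snoc_castSucc (α := fun _ : Fin (n + 2) => V) v x 0
    simp only [Fin.insertNth_last', hl, hfirst, rightEdge_last, Fin.snoc_last, NNReal.coe_one,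
      mul_one]
    calc _ = (∑ v, f v * (w (x (Fin.last n)) v : ℝ)) * (f (x 0) * buildingCount w x) := by
          rw [Finset.sum_mul]
          exact Finset.sum_congr rfl fun v _ => by ring
      _ = _ := by
          rw [sum_mul_weight_left h0 hc hf]
          ring
  have interior (j : Fin n) : ∑ x : Fin (n + 1) → V, ∑ v : V,
      f ((j.castSucc.succ.insertNth v x : Fin (n + 2) → V) 0) *
        f ((j.castSucc.succ.insertNth v x : Fin (n + 2) → V) (Fin.last (n + 1))) *
        (leftEdge w (j.castSucc.succ.insertNth v x : Fin (n + 2) → V) j.castSucc.succ *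
          rightEdge w (j.castSucc.succ.insertNth v x : Fin (n + 2) → V) j.castSucc.succ *
          buildingCount w x) =
      c ^ 2 * (Fintype.card V - 2) * endSum w f n := by
    rw [endSum, Finset.mul_sum]
    refine Finset.sum_congr rfl fun x _ => ?_
    have hfirst (v : V) : (j.castSucc.succ.insertNth v x : Fin (n + 2) → V) 0 = x 0 := by
      have := Fin.insertNth_apply_succAbove (α := fun _ : Fin (n + 2) => V) j.castSucc.succ v x 0
      rwa [Fin.succ_succAbove_zero] at this
    have hlast (v : V) : (j.castSucc.succ.insertNth v x : Fin (n + 2) → V) (Fin.last (n + 1)) =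
        x (Fin.last n) := by
      have := Fin.insertNth_apply_succAbove (α := fun _ : Fin (n + 2) => V) j.castSucc.succ v x
        (Fin.last n)
      rwa [Fin.succAbove_of_lt_succ _ _ (Fin.succ_lt_succ_iff.2 j.castSucc_lt_last),
        Fin.succ_last] at this
    have hl (v : V) : leftEdge w (j.castSucc.succ.insertNth v x : Fin (n + 2) → V)
        j.castSucc.succ = w (x j.castSucc) v := by
      have := Fin.insertNth_apply_succAbove (α := fun _ : Fin (n + 2) => V) j.castSucc.succ v x
        j.castSucc
      rw [Fin.succAbove_of_castSucc_lt _ _ j.castSucc.castSucc_lt_succ] at this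
      rw [leftEdge_succ, this, Fin.insertNth_apply_same]
    have hr (v : V) : rightEdge w (j.castSucc.succ.insertNth v x : Fin (n + 2) → V)
        j.castSucc.succ = w v (x j.succ) := by
      have := Fin.insertNth_apply_succAbove (α := fun _ : Fin (n + 2) => V) j.castSucc.succ v x
        j.succ
      rw [Fin.succAbove_of_lt_succ _ _ (Fin.succ_lt_succ_iff.2 j.castSucc_lt_succ)] at this
      have h := rightEdge_castSucc w (j.castSucc.succ.insertNth v x : Fin (n + 2) → V) j.succ
      rw [this, ← Fin.succ_castSucc, Fin.insertNth_apply_same] at h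
      exact h
    simp only [hfirst, hlast, hl, hr]
    -- The interior sum is c²(q - 2) only for distinct neighbours; for equal ones the shortened word
    -- has count 0.
    by_cases hj : x j.castSucc = x j.succ
    · rw [buildingCount_eq_zero w x j (by rw [hj, h0])]
      simp
    · rw [← sum_weight_mul_weight h0 hc hj, Finset.sum_mul]
      exact Finset.sum_congr rfl fun v _ => by ring
  rw [expand, Fin.sum_univ_succ, Fin.sum_univ_castSucc, first, Fin.succ_last, last,
    Finset.sum_congr rfl fun j _ => interior j, Finset.sum_const, Finset.card_univ,
    Fintype.card_fin, nsmul_eq_mul]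
  ring

/-- The end sum is a nonzero initial value times a product of the factors -2c + nc²(q - 2), so one
factor must vanish. -/
lemma exists_of_endSum_eq_zero {w : V → V → ℝ≥0} {c : ℝ} {f : V → ℝ}
    (h0 : ∀ i, w i i = 0) (hc : ∀ i j, i ≠ j → (w i j : ℝ) = c) (hf : ∑ v, f v = 0)
    (hcpos : 0 < c) (hne : ∑ v, f v * f v ≠ 0) {m : ℕ}
    (hm : endSum w f m = 0) : ∃ n < m, n * (c * ((Fintype.card V : ℝ) - 2)) = 2 := by
  induction m with
  | zero => exact absurd (endSum_zero w f ▸ hm) hne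
  | succ m ih =>
    rw [endSum_succ h0 hc hf] at hm
    rcases mul_eq_zero.1 hm with h | h
    · exact ⟨m, m.lt_succ_self, mul_left_cancel₀ hcpos.ne' (by linarith)⟩
    · obtain ⟨n, hn, h⟩ := ih h
      exact ⟨n, hn.trans m.lt_succ_self, h⟩

variable [MeasurableSpace V] [DiscreteMeasurableSpace V]

lemma IsInsertionProcess.integral_block {w : V → V → ℝ≥0} {μ : Measure (ℤ → V)}
    (hμ : IsInsertionProcess w μ) (i : ℤ) {n : ℕ} (g : (Fin n → V) → ℝ) :
    ∫ y, g (block i n y) ∂μ = ∑ x, insertionProb w x * g x := by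
  have := hμ.1
  have := Measure.isProbabilityMeasure_map (measurable_block i n).aemeasurable (μ := μ)
  rw [← integral_map (measurable_block i n).aemeasurable
    (measurable_of_finite g).aestronglyMeasurable, integral_fintype (.of_finite)]
  refine Finset.sum_congr rfl fun x _ => ?_
  rw [map_measureReal_apply (measurable_block i n) (measurableSet_singleton x),
    hμ.measureReal_block, smul_eq_mul]

/-- Up to normalization the end sum is the expectation of f(X₋₁)f(X_k), the ends of a word of length
k + 2. By independence it factors, and E f(X₋₁) = 0 since a single symbol is uniform. -/
lemma endSum_eq_zero_of_isKDependent {w : V → V → ℝ≥0} {f : V → ℝ} (hf : ∑ v, f v = 0)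
    (hw : Consistent w) {μ : Measure (ℤ → V)} (hμ : IsInsertionProcess w μ) {k : ℕ}
    (hk : IsKDependent k μ) : endSum w f (k + 1) = 0 := by
  have hprob := hμ.1
  have hfm : Measurable f := measurable_of_finite f
  have hind : IndepFun (fun y : ℤ → V => f (y (-1))) (fun y : ℤ → V => f (y k)) μ :=
    IndepFun.comp hk (φ := fun y : {i : ℤ // i < 0} → V => f (y ⟨-1, by norm_num⟩))
      (ψ := fun y : {i : ℤ // (k : ℤ) ≤ i} → V => f (y ⟨k, le_rfl⟩))
      (hfm.comp (measurable_pi_apply _)) (hfm.comp (measurable_pi_apply _))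
  have hmeas (i : ℤ) : AEStronglyMeasurable (fun y : ℤ → V => f (y i)) μ :=
    (hfm.comp (measurable_pi_apply i)).aestronglyMeasurable
  have h1 : ∫ y, f (y (-1)) ∂μ = 0 := by
    have := hμ.integral_block (-1) (n := 1) (fun x => f (x 0))
    simp only [block, insertionProb, buildingCount_one, ← Finset.mul_sum] at this
    simpa [sum_fin_succ_cons, hf] using this
  have h2 : ∫ y, f (y (-1)) * f (y k) ∂μ = 0 := by
    have := hind.integral_mul_eq_mul_integral (hmeas _) (hmeas _)
    rw [h1, zero_mul] at this
    exact this
  have h3 := hμ.integral_block (-1) (n := k + 2) (fun x => f (x 0) * f (x (Fin.last (k + 1))))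
  have h4 (y : ℤ → V) : f (block (-1) (k + 2) y 0) * f (block (-1) (k + 2) y (Fin.last (k + 1))) =
      f (y (-1)) * f (y k) := by
    simp [block]
  simp only [h4, h2] at h3
  have hZ : (totalCount w (k + 2) : ℝ) ≠ 0 := (NNReal.coe_pos.2 (hw.1 _)).ne'
  have h5 : endSum w f (k + 1) = totalCount w (k + 2) * 0 := by
    rw [h3, endSum, Finset.mul_sum]
    refine Finset.sum_congr rfl fun x _ => ?_
    rw [insertionProb, NNReal.coe_div]
    field_simp
  rw [h5, mul_zero]

end

end InsertionProcess

theorem theorem3 {V : Type*} [Fintype V] [MeasurableSpace V] [DiscreteMeasurableSpace V]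
    (w : V → V → NNReal) (hloopless : ∀ i : V, w i i = 0)
    (hpos : ∀ i j : V, i ≠ j → 0 < w i j) (k : ℕ) :
    (InsertionProcess.Consistent w ∧
      ∃ μ : MeasureTheory.Measure (ℤ → V),
        InsertionProcess.IsInsertionProcess w μ ∧ InsertionProcess.IsKDependent k μ) ↔
      (InsertionProcess.IsUnweightedComplete 3 w ∧ 2 ≤ k) ∨
        (InsertionProcess.IsUnweightedComplete 4 w ∧ 1 ≤ k) := by
  classical
  constructor
  · rintro ⟨hw, μ, hμ, hk⟩
    obtain ⟨c, hc, hwc, hc1⟩ := hw.exists_const hloopless hpos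
    have hV := hw.two_le_card hloopless
    obtain ⟨a, b, hab⟩ := Fintype.one_lt_card_iff.1 (show 1 < Fintype.card V by omega)
    -- Any nonzero function with sum zero would do.
    let f : V → ℝ := Pi.single a 1 - Pi.single b 1
    have hf : ∑ v, f v = 0 := by simp [f]
    have hff : ∑ v, f v * f v ≠ 0 := by
      refine (Finset.sum_pos' (fun v _ => mul_self_nonneg _) ⟨a, Finset.mem_univ a, ?_⟩).ne'
      simp [f, hab]
    obtain ⟨n, hn, h⟩ := InsertionProcess.exists_of_endSum_eq_zero hloopless hwc hf hc hff
      (InsertionProcess.endSum_eq_zero_of_isKDependent hf hw hμ hk)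
    -- With two vertices the equation obtained reads 0 = 2, whatever c is.
    have hcard : 3 ≤ Fintype.card V := by
      by_contra h'
      have h2 : Fintype.card V = 2 := by omega
      rw [h2] at h
      norm_num at h
    obtain rfl := hc1 hcard
    have h1 (i j : V) (hij : i ≠ j) : w i j = 1 := NNReal.coe_injective (hwc i j hij)
    -- With q = 3 + r and c = 1 the equation is n(r + 1) = 2 in natural numbers, so r + 1 divides 2;
    -- the bound on k is n ≤ k.
    obtain ⟨r, hr⟩ := Nat.exists_eq_add_of_le hcard
    have hnr : n * (r + 1) = 2 := by
      rw [hr] at h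
      have : (n * (r + 1) : ℝ) = 2 := by
        rw [← h]
        push_cast
        ring
      exact_mod_cast this
    have hr2 : r + 1 ≤ 2 := Nat.le_of_dvd two_pos ⟨n, by rw [← hnr, mul_comm]⟩
    obtain rfl | rfl : r = 0 ∨ r = 1 := by omega
    · exact Or.inl ⟨InsertionProcess.isUnweightedComplete_of_card hloopless h1 hr, by omega⟩
    · exact Or.inr ⟨InsertionProcess.isUnweightedComplete_of_card hloopless h1 hr, by omega⟩
  · rintro (⟨h, hk⟩ | ⟨h, hk⟩)
    · have hw := InsertionProcess.consistent_of_complete h.weight_self h.weight_of_ne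
        (by rw [h.card_eq]; norm_num)
      obtain ⟨μ, hμ⟩ := InsertionProcess.exists_isInsertionProcess hw
      exact ⟨hw, μ, hμ, (hμ.isKDependent
        (InsertionProcess.gapFactorizes_two h.weight_self h.weight_of_ne h.card_eq)).mono hk⟩
    · have hw := InsertionProcess.consistent_of_complete h.weight_self h.weight_of_ne
        (by rw [h.card_eq]; norm_num)
      obtain ⟨μ, hμ⟩ := InsertionProcess.exists_isInsertionProcess hw
      exact ⟨hw, μ, hμ, (hμ.isKDependent
        (InsertionProcess.gapFactorizes_one h.weight_self h.weight_of_ne h.card_eq)).mono hk⟩
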